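/- **Setting.** Let $D$ be the front diagram of an oriented Legendrian link $L\subset(\mathbb R^3,\ker(dz-y\,dx))$ with $c$ components whose crossings and cusps have distinct $x$-coordinates; strands over a vertical line are numbered from top to bottom. All objects below depend only on the left-to-right sequence of crossings and cusps of $D$, and positions of marks along the $x$-axis matter only up to moving them without passing another mark, crossing or cusp. Choose on each component $L_k$ a marked point $*_k$ at a right cusp. Let $r(L)$ be the gcd of the rotation numbers of the components, $\mu$ a Maslov potential with values in $\mathbb Z/2r(L)$ (equal to one more on the upper than on the lower strand at every cusp), $m\ge 0$ a divisor of $2r(L)$, and $\mathbb F$ a field. The degree of a crossing is the difference of $\mu$ on the over-strand (the one of lesser slope) and the under-strand. **Normal rulings.** A normal ruling $\rho$ assigns to each vertical strip between consecutive crossings/cusps a fixed-point free involution of the strands over it such that: the two strands at a cusp are paired, and the pairing of the other strands does not change at a cusp; at a crossing of strands $k,k+1$, with involutions $\sigma$ before and $\tau$ after, $\sigma(k)\ne k+1$ and either $\tau=(k\ k{+}1)\,\sigma\,(k\ k{+}1)$, or the crossing is a *switch*: $\sigma=\tau$ and $\sigma$ is of one of the types (1) $\sigma(k)<k<k+1<\sigma(k+1)$,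 (2) $\sigma(k+1)<\sigma(k)<k<k+1$, (3) $k<k+1<\sigma(k+1)<\sigma(k)$. A crossing which is not a switch is a *return* if $\tau$ is of one of these types; the type of a return is that of $\tau$. Joining paired strands along paths which cross at crossings that are not switches and turn a corner at switches decomposes $D$ into boundaries of disks, each with one left and one right cusp. In type (1) the two disks at a switch are disjoint, the disk of strand $k$ being the upper one; in types (2), (3) they are nested, the inner disk being that of $k$ in type (2) and that of $k+1$ in type (3). $\rho$ is $m$-graded if all switches have degree $0$ mod $m$; a return is $m$-graded if it has degree $0$ mod $m$. Fix an $m$-graded normal ruling $\rho$ with $n$ switches. Let $r$ be the number of $m$-graded returns, plus the number of right cusps if $m=1$. **Morse complex sequences.** A handleslide mark is a vertical segment with endpoints on strands $j<k$, with a coefficient in $\mathbb F$. An MCS $\mathcal C$ for $D$ consists of finitely many handleslide marks, with $x$-coordinates distinct from each other and from those of crossings and cusps, and, on each vertical line in a sequence separating all marks, crossings and cusps, a differential $d$ ($d^2=0$) on the free $\mathbb F$-module with basis the strands $e_1,e_2,\dots$ there, with $de_j\in\mathrm{span}\{e_k:k>j\}$, such that: * adjacent to a crossing of strands $k,k+1$,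 $\langle de_k,e_{k+1}\rangle=0$; after a left cusp it equals $1$; before an unmarked right cusp it equals $-1$; before the cusp carrying $*_i$ it equals $-s_i$ with $s_i\in\mathbb F^\times$ ($\mathcal C$ *assigns the value* $s_i$ to $*_i$); * passing a crossing, exchanging $e_k$ and $e_{k+1}$ is an isomorphism of complexes; passing a handleslide with coefficient $q$ between $j<k$, the map $e_j\mapsto e_j-qe_k$, $e_i\mapsto e_i$ ($i\ne j$) is an isomorphism of complexes; at a cusp of strands $k,k+1$, the obvious map on the remaining strands is an isomorphism from the smaller complex to the quotient of the larger one by $\mathrm{span}\{e_k,de_k\}$. $\mathcal C$ is $m$-graded if all $d$ have degree $-1$ mod $m$ (strands being graded by $\mu$) and handleslides join strands with equal $\mu$ mod $m$. It is in *SR-form compatible with $\rho$* if it is $m$-graded, every left cusp is simple (just after it $de_k=e_{k+1}$, and $e_k,e_{k+1}$ do not occur in $de_j$ for $j<k$), and its handleslides are exactly the following, where "disk coefficient" means the coefficient of the lower in the differential of the upper boundary strand of a disk, on the line immediately before the handleslides in question: * at each switch, for some $q\in\mathbb F^\times$: a handleslide with coefficient $q$ immediately before and one with coefficient $-q^{-1}$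 immediately after the crossing, both joining strands $k,k+1$; in types (2), (3), immediately after these a third one joining the companions of the crossing strands, with coefficient $aq^{-1}b^{-1}$, where $a$ and $b$ are the disk coefficients of the outer and inner disk; * at each $m$-graded return, for some $q\in\mathbb F$: a handleslide with coefficient $q$ joining $k,k+1$ immediately before the crossing; in types (2), (3) also one immediately after the crossing joining the companions, with coefficient $aqb^{-1}$ in type (2) and $a^{-1}qb$ in type (3), where $a$ and $b$ are the disk coefficients of the upper and lower of the two (interlaced) disks before the crossing; * if $m=1$, at each right cusp: a handleslide with arbitrary coefficient $q\in\mathbb F$ immediately before the cusp, joining the two strands of the cusp. Let $\mathit{MCS}^\rho_m(D;\mathbb F)$ be the set of all such MCSs. **Disk equations.** For each disk $D_i$ of $\rho$ let $(R_i)$ be the equation $\prod_j y_j=w_i$ in the variables $t_1,\dots,t_c$, $x_1,\dots,x_n$, the product being over the switches $s_j$ involving $D_i$, with $w_i=-t_k$ if the right cusp of $D_i$ carries $*_k$ and $w_i=-1$ if it is unmarked, and $y_j=-x_j$ (resp. $x_j$) if $s_j$ has type (1) and $D_i$ is the upper (resp. lower) disk, $y_j=-x_j$ (resp. $x_j^{-1}$)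 if $s_j$ has type (2) or (3) and $D_i$ is the inner (resp. outer) disk. **Theorem 4.4.** The set $\mathit{MCS}^\rho_m(D;\mathbb F)$ is in bijection with the solution set $$Z_\rho\subset(\mathbb F^\times)^c\times(\mathbb F^\times)^n\times\mathbb F^r=\{(t_1,\dots,t_c,x_1,\dots,x_n,z_1,\dots,z_r)\}$$ of the disk equations. More precisely, there is a bijection $\Lambda:Z_\rho\to\mathit{MCS}^\rho_m(D;\mathbb F)$ such that $\Lambda(t,x,z)$ assigns the value $t_k$ to $*_k$ for each $k$, has first (leftmost) handleslide coefficient $x_j$ at the $j$-th switch if this is of type (1) or (2) and $-x_j$ if it is of type (3), and has first handleslide coefficients $z_1,\dots,z_r$ at the $m$-graded returns (and right cusps if $m=1$). -/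

import Mathlib

open scoped Classical

noncomputable section

namespace Legendrian

/-! ## Front diagrams -/

/-- An elementary piece of a front diagram containing exactly one left cusp, crossing or right
cusp, with `s` strands at its left end and `t` strands at its right end. Strands are numbered
`0, 1, 2, …` from top to bottom; the cusp or crossing involves the strands `k` and `k + 1`. -/
inductive Piece : ℕ → ℕ → Type
  | leftCusp {s : ℕ} (k : ℕ) (hk : k ≤ s) : Piece s (s + 2)
  | crossing {s : ℕ} (k : ℕ) (hk : k + 1 < s) : Piece s s
  | rightCusp {s : ℕ} (k : ℕ) (hk : k ≤ s) : Piece (s + 2) s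

/-- The order preserving injection of strand labels which omits the labels `k` and `k + 1`. -/
def skip {s : ℕ} (k : ℕ) (p : Fin s) : Fin (s + 2) :=
  if (p : ℕ) < k then ⟨p, by omega⟩ else ⟨p + 2, by omega⟩

/-- The transposition `(k k+1)` of strand labels. -/
def cross {s : ℕ} (k : ℕ) (hk : k + 1 < s) : Equiv.Perm (Fin s) :=
  Equiv.swap ⟨k, by omega⟩ ⟨k + 1, hk⟩

namespace Piece

/-- The strands `u` (upper) and `l` (lower) at the right end of the piece meet at a left cusp. -/
def IsLeftCuspAt {s t : ℕ} : Piece s t → Fin t → Fin t → Prop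
  | leftCusp k _, u, l => (u : ℕ) = k ∧ (l : ℕ) = k + 1
  | _, _, _ => False

/-- The strands `u` (upper) and `l` (lower) at the left end of the piece meet at a right cusp. -/
def IsRightCuspAt {s t : ℕ} : Piece s t → Fin s → Fin s → Prop
  | rightCusp k _, u, l => (u : ℕ) = k ∧ (l : ℕ) = k + 1
  | _, _, _ => False

/-- The strands `u` (upper) and `l` (lower) at the left end of the piece meet at a crossing. -/
def IsCrossingAt {s t : ℕ} : Piece s t → Fin s → Fin s → Prop
  | crossing k _, u, l => (u : ℕ) = k ∧ (l : ℕ) = k + 1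
  | _, _, _ => False

/-- The strand `p` at the left end of the piece continues, along the link, to the strand `q` at
its right end. -/
def Joins {s t : ℕ} : Piece s t → Fin s → Fin t → Prop
  | leftCusp k _, p, q => q = skip k p
  | crossing k hk, p, q => q = cross k hk p
  | rightCusp k _, p, q => p = skip k q

end Piece

/-- The front diagram of a Legendrian link whose crossings and cusps have pairwise distinct
`x`-coordinates, recorded as the left-to-right sequence of its `numEvents` crossings and cusps.
The crossings and cusps cut the plane into `numEvents + 1` vertical strips; `strands i` is the
number of strands over the `i`-th strip. -/
structure FrontDiagram where
  numEvents : ℕ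
  strands : Fin (numEvents + 1) → ℕ
  piece : ∀ i : Fin numEvents, Piece (strands i.castSucc) (strands i.succ)
  strands_first : strands 0 = 0
  strands_last : strands (Fin.last numEvents) = 0

namespace FrontDiagram

variable (D : FrontDiagram)

/-- The strands of `D`: a strip together with the label of a strand over this strip. -/
abbrev Strand : Type := Σ i : Fin (D.numEvents + 1), Fin (D.strands i)

/-- Two strands are adjacent along the link: one continues to the other through a crossing or
past a cusp of other strands, or they share a cusp. -/
inductive Adjacent : D.Strand → D.Strand → Prop
  | through (i : Fin D.numEvents) (p : Fin (D.strands i.castSucc)) (q : Fin (D.strands i.succ)) :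
      (D.piece i).Joins p q → Adjacent ⟨i.castSucc, p⟩ ⟨i.succ, q⟩
  | leftCusp (i : Fin D.numEvents) (u l : Fin (D.strands i.succ)) :
      (D.piece i).IsLeftCuspAt u l → Adjacent ⟨i.succ, u⟩ ⟨i.succ, l⟩
  | rightCusp (i : Fin D.numEvents) (u l : Fin (D.strands i.castSucc)) :
      (D.piece i).IsRightCuspAt u l → Adjacent ⟨i.castSucc, u⟩ ⟨i.castSucc, l⟩

/-- The components of the link (classes for the equivalence relation generated by adjacency). -/
def Component : Type := Quot D.Adjacent

/-- The component containing a strand. -/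
def component (a : D.Strand) : D.Component := Quot.mk _ a

instance : Finite D.Component := inferInstanceAs (Finite (Quot D.Adjacent))

instance : Fintype D.Component := Fintype.ofFinite _

/-- One marked point on each component of the link, located at a right cusp. -/
structure MarkedPoints where
  cusp : D.Component → Fin D.numEvents
  spec : ∀ K, ∃ u l, (D.piece (cusp K)).IsRightCuspAt u l ∧
    D.component ⟨(cusp K).castSucc, u⟩ = K

/-- An orientation of the link; `right a` says that the strand `a` is oriented from left to
right. -/
structure Orientation where
  right : D.Strand → Prop
  through : ∀ i p q, (D.piece i).Joins p q → (right ⟨i.castSucc, p⟩ ↔ right ⟨i.succ, q⟩)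
  leftCusp : ∀ i u l, (D.piece i).IsLeftCuspAt u l → (right ⟨i.succ, u⟩ ↔ ¬ right ⟨i.succ, l⟩)
  rightCusp : ∀ i u l, (D.piece i).IsRightCuspAt u l →
    (right ⟨i.castSucc, u⟩ ↔ ¬ right ⟨i.castSucc, l⟩)

variable {D}

namespace Orientation

variable (o : D.Orientation)

/-- The cusps on the component `K` which are traversed downwards. -/
def downCusps (K : D.Component) : Set (Fin D.numEvents) :=
  {i | (∃ u l, (D.piece i).IsLeftCuspAt u l ∧ D.component ⟨i.succ, l⟩ = K ∧
          o.right ⟨i.succ, l⟩) ∨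
       (∃ u l, (D.piece i).IsRightCuspAt u l ∧ D.component ⟨i.castSucc, u⟩ = K ∧
          o.right ⟨i.castSucc, u⟩)}

/-- The cusps on the component `K` which are traversed upwards. -/
def upCusps (K : D.Component) : Set (Fin D.numEvents) :=
  {i | (∃ u l, (D.piece i).IsLeftCuspAt u l ∧ D.component ⟨i.succ, u⟩ = K ∧
          o.right ⟨i.succ, u⟩) ∨
       (∃ u l, (D.piece i).IsRightCuspAt u l ∧ D.component ⟨i.castSucc, l⟩ = K ∧
          o.right ⟨i.castSucc, l⟩)}

/-- The rotation number of a component: half of the number of down cusps minus the number of up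
cusps (this difference is even). -/
def rotation (K : D.Component) : ℤ :=
  (((o.downCusps K).ncard : ℤ) - ((o.upCusps K).ncard : ℤ)) / 2

/-- The rotation number `r(L)` of the link: the greatest common divisor of the rotation numbers
of its components. -/
def linkRotation : ℕ := Finset.univ.gcd fun K : D.Component => (o.rotation K).natAbs

end Orientation

variable (D) in
/-- A Maslov potential with values in `ℤ/N`. -/
structure MaslovPotential (N : ℕ) where
  toFun : D.Strand → ZMod N
  through : ∀ i p q, (D.piece i).Joins p q → toFun ⟨i.castSucc, p⟩ = toFun ⟨i.succ, q⟩
  leftCusp : ∀ i u l, (D.piece i).IsLeftCuspAt u l → toFun ⟨i.succ, u⟩ = toFun ⟨i.succ, l⟩ + 1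
  rightCusp : ∀ i u l, (D.piece i).IsRightCuspAt u l →
    toFun ⟨i.castSucc, u⟩ = toFun ⟨i.castSucc, l⟩ + 1

namespace MaslovPotential

variable {N m : ℕ} (μ : D.MaslovPotential N)

/-- The residue mod `m` of the Maslov potential of a strand, for `m` a divisor of `N`. -/
def reduce (hm : m ∣ N) (a : D.Strand) : ZMod m := ZMod.castHom hm (ZMod m) (μ.toFun a)

/-- The `i`-th event is a crossing whose degree (Maslov potential of the over-strand, the one of
lesser slope, minus that of the under-strand) is `0` mod `m`. -/
def CrossingDegreeZero (hm : m ∣ N) (i : Fin D.numEvents) : Prop :=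
  ∃ u l, (D.piece i).IsCrossingAt u l ∧
    ZMod.castHom hm (ZMod m) (μ.toFun ⟨i.castSucc, u⟩ - μ.toFun ⟨i.castSucc, l⟩) = 0

end MaslovPotential

end FrontDiagram

/-! ## Normal rulings -/

section Patterns

variable {s : ℕ} (σ : Equiv.Perm (Fin s)) (a b : Fin s)

/-- For adjacent strands `a` (upper) and `b` (lower): the disks are disjoint (types S1, R1). -/
def DisjointDisks : Prop := σ a < a ∧ b < σ b

/-- For adjacent strands `a` (upper) and `b` (lower): the disks are nested and both companions lie
above (types S2, R2). The disk of `a` is the inner one. -/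
def NestedAbove : Prop := σ b < σ a ∧ σ a < a

/-- For adjacent strands `a` (upper) and `b` (lower): the disks are nested and both companions lie
below (types S3, R3). The disk of `b` is the inner one. -/
def NestedBelow : Prop := b < σ b ∧ σ b < σ a

/-- The normality condition. -/
def Normality : Prop := DisjointDisks σ a b ∨ NestedAbove σ a b ∨ NestedBelow σ a b

end Patterns

namespace Piece

/-- The condition relating the involutions of a normal ruling on the two sides of a piece. -/
def RulingStep {s t : ℕ} : Piece s t → Equiv.Perm (Fin s) → Equiv.Perm (Fin t) → Prop
  | leftCusp (s := s) k hk, σ, τ =>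
      τ (⟨k, by omega⟩ : Fin (s + 2)) = ⟨k + 1, by omega⟩ ∧ ∀ p, τ (skip k p) = skip k (σ p)
  | crossing k hk, σ, τ =>
      σ ⟨k, by omega⟩ ≠ ⟨k + 1, hk⟩ ∧
        (τ = cross k hk * σ * cross k hk ∨
          (σ = τ ∧ Normality σ ⟨k, by omega⟩ ⟨k + 1, hk⟩))
  | rightCusp (s := s) k hk, σ, τ =>
      σ (⟨k, by omega⟩ : Fin (s + 2)) = ⟨k + 1, by omega⟩ ∧ ∀ p, σ (skip k p) = skip k (τ p)

/-- The piece contains a crossing which is a switch. -/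
def IsSwitch {s t : ℕ} : Piece s t → Equiv.Perm (Fin s) → Equiv.Perm (Fin t) → Prop
  | crossing k hk, σ, τ => σ = τ ∧ Normality σ ⟨k, by omega⟩ ⟨k + 1, hk⟩
  | _, _, _ => False

/-- The piece contains a crossing which is a return: it is not a switch, and the normality
condition holds after the crossing. -/
def IsReturn {s t : ℕ} : Piece s t → Equiv.Perm (Fin s) → Equiv.Perm (Fin t) → Prop
  | crossing k hk, σ, τ =>
      τ = cross k hk * σ * cross k hk ∧ Normality τ ⟨k, by omega⟩ ⟨k + 1, hk⟩
  | _, _, _ => False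

/-- The piece contains a crossing at which both companions lie below the crossing strands, in a
nested configuration; for a switch this says that it has type S3. -/
def IsNestedBelow {s t : ℕ} : Piece s t → Equiv.Perm (Fin s) → Prop
  | crossing k hk, σ => NestedBelow σ ⟨k, by omega⟩ ⟨k + 1, hk⟩
  | _, _ => False

/-- The strand `p` at the left end of the piece continues to the strand `q` at its right end
along the boundary paths of the disks of a ruling: these paths turn a corner at switches. -/
def RulingJoins {s t : ℕ} : Piece s t → Equiv.Perm (Fin s) → Equiv.Perm (Fin t) →
    Fin s → Fin t → Prop
  | leftCusp k _, _, _, p, q => q = skip k p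
  | crossing k hk, σ, τ, p, q => q = if IsSwitch (crossing k hk) σ τ then p else cross k hk p
  | rightCusp k _, _, _, p, q => p = skip k q

end Piece

namespace FrontDiagram

/-- A normal ruling of `D`: a fixed-point free involution of the strands over each strip, subject
to the requirements at cusps and crossings. -/
structure NormalRuling (D : FrontDiagram) where
  pairing : ∀ i : Fin (D.numEvents + 1), Equiv.Perm (Fin (D.strands i))
  involutive : ∀ i p, pairing i (pairing i p) = p
  fixedPointFree : ∀ i p, pairing i p ≠ p
  step : ∀ i : Fin D.numEvents, (D.piece i).RulingStep (pairing i.castSucc) (pairing i.succ)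

namespace NormalRuling

variable {D : FrontDiagram} {N m : ℕ} (ρ : D.NormalRuling) (μ : D.MaslovPotential N) (hm : m ∣ N)

/-- The `i`-th event is a switch. -/
def IsSwitch (i : Fin D.numEvents) : Prop :=
  (D.piece i).IsSwitch (ρ.pairing i.castSucc) (ρ.pairing i.succ)

/-- The `i`-th event is a return. -/
def IsReturn (i : Fin D.numEvents) : Prop :=
  (D.piece i).IsReturn (ρ.pairing i.castSucc) (ρ.pairing i.succ)

/-- A normal ruling is `m`-graded if all its switches have degree `0` mod `m`. -/
def IsGraded : Prop := ∀ i, ρ.IsSwitch i → μ.CrossingDegreeZero hm i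

/-- The switches of the ruling. -/
abbrev Switch : Type := {i : Fin D.numEvents // ρ.IsSwitch i}

/-- The `i`-th event is an `m`-graded return or, if `m = 1`, a right cusp. -/
def IsGradedReturnOrCusp (i : Fin D.numEvents) : Prop :=
  (ρ.IsReturn i ∧ μ.CrossingDegreeZero hm i) ∨
    (m = 1 ∧ ∃ u l, (D.piece i).IsRightCuspAt u l)

/-- The `m`-graded returns of the ruling, together with the right cusps if `m = 1`. -/
abbrev GradedReturnOrCusp : Type := {i : Fin D.numEvents // ρ.IsGradedReturnOrCusp μ hm i}

/-- Adjacency along the boundary of a common disk of the ruling. -/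
inductive DiskAdjacent : D.Strand → D.Strand → Prop
  | companion (i : Fin (D.numEvents + 1)) (p : Fin (D.strands i)) :
      DiskAdjacent ⟨i, p⟩ ⟨i, ρ.pairing i p⟩
  | through (i : Fin D.numEvents) (p : Fin (D.strands i.castSucc)) (q : Fin (D.strands i.succ)) :
      (D.piece i).RulingJoins (ρ.pairing i.castSucc) (ρ.pairing i.succ) p q →
      DiskAdjacent ⟨i.castSucc, p⟩ ⟨i.succ, q⟩

/-- The disks of the ruling, each identified with the set of strands along its boundary (a class
for the equivalence relation generated by `DiskAdjacent`). -/
def Disk : Type := Quot ρ.DiskAdjacent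

/-- The disk having a given strand on its boundary. -/
def disk (a : D.Strand) : ρ.Disk := Quot.mk _ a

/-- The `i`-th event is a right cusp at which the disk `δ` ends. -/
def EndsAt (δ : ρ.Disk) (i : Fin D.numEvents) : Prop :=
  ∃ u l, (D.piece i).IsRightCuspAt u l ∧ ρ.disk ⟨i.castSucc, u⟩ = δ

end NormalRuling

end FrontDiagram

/-! ## The disk equations -/

/-- The factor contributed by a switch with variable `x` to the equation of a disk, where `inDisk`
tells which strands at the left end of the piece bound the disk. It is `1` if the switch does not
involve the disk. -/
def Piece.diskFactor {s t : ℕ} {F : Type*} [Field F] :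
    Piece s t → Equiv.Perm (Fin s) → (Fin s → Prop) → Fˣ → Fˣ
  | .crossing (s := s) k hk, σ, inDisk, x =>
      let a : Fin s := ⟨k, by omega⟩
      let b : Fin s := ⟨k + 1, hk⟩
      if DisjointDisks σ a b then
        -- upper disk, lower disk
        if inDisk a then -x else if inDisk b then x else 1
      else if NestedAbove σ a b then
        -- inner disk, outer disk
        if inDisk a then -x else if inDisk b then x⁻¹ else 1
      else
        -- inner disk, outer disk
        if inDisk b then -x else if inDisk a then x⁻¹ else 1
  | _, _, _, _ => 1

namespace FrontDiagram

namespace NormalRuling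

variable {D : FrontDiagram} {N m : ℕ} (ρ : D.NormalRuling) (μ : D.MaslovPotential N) (hm : m ∣ N)
  (F : Type*) [Field F]

/-- The space `(F^×)^c × (F^×)^n × F^r`, whose coordinates `t`, `x`, `z` are indexed by the
components of the link, the switches of the ruling, and the `m`-graded returns (and right cusps if
`m = 1`). -/
abbrev ParamSpace : Type _ :=
  (D.Component → Fˣ) × (ρ.Switch → Fˣ) × (ρ.GradedReturnOrCusp μ hm → F)

variable {F}

/-- The left-hand side of the disk equation of `δ`. -/
def diskProduct (x : ρ.Switch → Fˣ) (δ : ρ.Disk) : Fˣ :=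
  ∏ j : ρ.Switch, (D.piece j.1).diskFactor (ρ.pairing j.1.castSucc)
    (fun p => ρ.disk ⟨j.1.castSucc, p⟩ = δ) (x j)

/-- The disk equation of `δ`: the product of its factors is `-t K` if `δ` ends at the marked right
cusp of the component `K`, and `-1` if `δ` does not end at a marked right cusp. -/
def DiskEquation (M : D.MarkedPoints) (t : D.Component → Fˣ) (x : ρ.Switch → Fˣ) (δ : ρ.Disk) :
    Prop :=
  (∀ K, ρ.EndsAt δ (M.cusp K) → ρ.diskProduct x δ = -t K) ∧
    ((∀ K, ¬ ρ.EndsAt δ (M.cusp K)) → ρ.diskProduct x δ = -1)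

variable (F) in
/-- The solution set `Z_ρ` of the disk equations. -/
def diskVariety (M : D.MarkedPoints) : Set (ρ.ParamSpace μ hm F) :=
  {P | ∀ δ, ρ.DiskEquation M P.1 P.2.1 δ}

end NormalRuling

end FrontDiagram

/-! ## Morse complex sequences -/

/-- A complex on the free module with basis `e_0, …, e_{s-1}` whose differential is (strictly)
triangular. -/
@[ext]
structure TriComplex (R : Type*) [CommRing R] (s : ℕ) where
  d : (Fin s → R) →ₗ[R] (Fin s → R)
  d_sq : d ∘ₗ d = 0
  triangular : ∀ j k : Fin s, ¬ j < k → d (Pi.single j 1) k = 0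

/-- The coefficient `⟨d e_j, e_k⟩`. -/
def TriComplex.coeff {R : Type*} [CommRing R] {s : ℕ} (C : TriComplex R s) (j k : Fin s) : R :=
  C.d (Pi.single j 1) k

/-- The linear map with prescribed values on the basis vectors `e_i`. -/
def onBasis {R : Type*} [CommRing R] {s t : ℕ} (f : Fin s → (Fin t → R)) :
    (Fin s → R) →ₗ[R] (Fin t → R) :=
  (Pi.basisFun R (Fin s)).constr R f

/-- `φ` is an isomorphism of complexes from `C` to `C'`. -/
def IsComplexIso {R : Type*} [CommRing R] {s t : ℕ} (C : TriComplex R s) (C' : TriComplex R t)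
    (φ : (Fin s → R) →ₗ[R] (Fin t → R)) : Prop :=
  Function.Bijective φ ∧ φ ∘ₗ C.d = C'.d ∘ₗ φ

/-- `S` is the larger complex at a cusp between the strands `k` and `k + 1`, and `C` the smaller
one: `e_i ↦ [e_{skip k i}]` is an isomorphism of complexes from `C` to the quotient of `S` by the
subcomplex `W` spanned by `e_k` and `d e_k` (the differential of the quotient is the one induced by
the differential of `S`). -/
def IsCuspQuotient {R : Type*} [CommRing R] {s : ℕ} (k : ℕ) (hk : k ≤ s)
    (S : TriComplex R (s + 2)) (C : TriComplex R s) : Prop :=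
  let e : Fin (s + 2) → R := Pi.single ⟨k, by omega⟩ 1
  let W : Submodule R (Fin (s + 2) → R) := Submodule.span R {e, S.d e}
  let φ : (Fin s → R) →ₗ[R] (Fin (s + 2) → R) := onBasis fun i => Pi.single (skip k i) 1
  Function.Bijective (W.mkQ ∘ₗ φ) ∧ W.mkQ ∘ₗ φ ∘ₗ C.d = W.mkQ ∘ₗ S.d ∘ₗ φ

/-- A handleslide mark: its two endpoints (strands over a strip) and its coefficient. -/
@[ext]
structure Handleslide (R : Type*) (s : ℕ) where
  upper : Fin s
  lower : Fin s
  coeff : R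

/-- The map `e_j ↦ e_j - r e_k`, `e_i ↦ e_i` for `i ≠ j`, of a handleslide between the strands
`j < k` with coefficient `r`. -/
def Handleslide.map {R : Type*} [CommRing R] {s : ℕ} (h : Handleslide R s) :
    (Fin s → R) →ₗ[R] (Fin s → R) :=
  onBasis fun i => if i = h.upper then Pi.single h.upper 1 - h.coeff • Pi.single h.lower 1
    else Pi.single i 1

namespace Piece

variable {R : Type*} [CommRing R]

/-- The relation between the complexes immediately before and immediately after a crossing or
cusp. -/
def ComplexStep {s t : ℕ} : Piece s t → TriComplex R s → TriComplex R t → Prop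
  | leftCusp k hk, C, C' => IsCuspQuotient k hk C' C
  | crossing k hk, C, C' => IsComplexIso C C' (onBasis fun i => Pi.single (cross k hk i) 1)
  | rightCusp k hk, C, C' => IsCuspQuotient k hk C C'

/-- The requirement on the coefficient `⟨d e_k, e_{k+1}⟩` next to a crossing or cusp; `marked` says
whether the piece carries a marked point. -/
def CoeffCondition {s t : ℕ} (marked : Prop) : Piece s t → TriComplex R s → TriComplex R t → Prop
  | leftCusp k hk, _, C' => C'.coeff ⟨k, by omega⟩ ⟨k + 1, by omega⟩ = 1
  | crossing k hk, C, C' =>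
      C.coeff ⟨k, by omega⟩ ⟨k + 1, hk⟩ = 0 ∧ C'.coeff ⟨k, by omega⟩ ⟨k + 1, hk⟩ = 0
  | rightCusp k hk, C, _ =>
      if marked then ∃ v : Rˣ, C.coeff ⟨k, by omega⟩ ⟨k + 1, by omega⟩ = -(v : R)
      else C.coeff ⟨k, by omega⟩ ⟨k + 1, by omega⟩ = -1

/-- The piece is not a left cusp, or it is a left cusp between the strands `k` and `k + 1` which is
simple for the complex immediately after it. -/
def LeftCuspSimple {s t : ℕ} : Piece s t → TriComplex R t → Prop
  | leftCusp (s := s) k hk, C' =>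
      C'.d (Pi.single ⟨k, by omega⟩ 1) = Pi.single ⟨k + 1, by omega⟩ 1 ∧
        ∀ j : Fin (s + 2), (j : ℕ) < k →
          C'.coeff j ⟨k, by omega⟩ = 0 ∧ C'.coeff j ⟨k + 1, by omega⟩ = 0
  | _, _ => True

end Piece

namespace FrontDiagram

/-- A Morse complex sequence over `R` for the front diagram `D` with marked points `M`.

Over each strip, `marks i` lists the handleslide marks from left to right. The vertical lines
`x = x_l` separate the crossings, cusps and handleslides; over the strip `i` there is one such line
before, between and after the marks in `marks i`, and `cx i j` is the complex on the line which has
exactly `j` marks of the strip on its left. -/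
structure MCS (D : FrontDiagram) (M : D.MarkedPoints) (R : Type*) [CommRing R] where
  marks : ∀ i : Fin (D.numEvents + 1), List (Handleslide R (D.strands i))
  marks_lt : ∀ i, ∀ h ∈ marks i, h.upper < h.lower
  cx : ∀ i : Fin (D.numEvents + 1), Fin ((marks i).length + 1) → TriComplex R (D.strands i)
  slide : ∀ i (j : Fin (marks i).length),
    IsComplexIso (cx i j.castSucc) (cx i j.succ) ((marks i).get j).map
  coeffCondition : ∀ i : Fin D.numEvents, (D.piece i).CoeffCondition (∃ K, M.cusp K = i)
    (cx i.castSucc (Fin.last _)) (cx i.succ 0)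
  step : ∀ i : Fin D.numEvents, (D.piece i).ComplexStep
    (cx i.castSucc (Fin.last _)) (cx i.succ 0)

namespace MCS

variable {D : FrontDiagram} {M : D.MarkedPoints} {R : Type*} [CommRing R] {N m : ℕ}

/-- The sequence assigns the value `v` to the marked point of the component `K`. -/
def AssignsValue (C : D.MCS M R) (K : D.Component) (v : Rˣ) : Prop :=
  ∃ u l, (D.piece (M.cusp K)).IsRightCuspAt u l ∧
    (C.cx (M.cusp K).castSucc (Fin.last _)).coeff u l = -(v : R)

/-- The sequence is `m`-graded: its differentials have degree `-1` mod `m`, and handleslide marks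
end on strands of equal Maslov potential mod `m`. -/
def IsGraded (C : D.MCS M R) (μ : D.MaslovPotential N) (hm : m ∣ N) : Prop :=
  (∀ i l j k, (C.cx i l).coeff j k ≠ 0 → μ.reduce hm ⟨i, k⟩ = μ.reduce hm ⟨i, j⟩ - 1) ∧
    ∀ i, ∀ h ∈ C.marks i, μ.reduce hm ⟨i, h.upper⟩ = μ.reduce hm ⟨i, h.lower⟩

/-- Every left cusp is simple. -/
def HasSimpleLeftCusps (C : D.MCS M R) : Prop :=
  ∀ i : Fin D.numEvents, (D.piece i).LeftCuspSimple (C.cx i.succ 0)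

/-- The complex over the strip `i` just before the last handleslide mark of this strip. -/
def beforeLast (C : D.MCS M R) (i : Fin (D.numEvents + 1)) : TriComplex R (D.strands i) :=
  C.cx i ⟨(C.marks i).length - 1, by omega⟩

end MCS

end FrontDiagram

/-! ## SR-form -/

/-- The handleslide mark immediately to the left of a switch, return or right cusp. -/
def Piece.leftMarks {s t : ℕ} {F : Type*} : Piece s t → F → List (Handleslide F s)
  | .leftCusp _ _, _ => []
  | .crossing k hk, r => [⟨⟨k, by omega⟩, ⟨k + 1, hk⟩, r⟩]
  | .rightCusp k hk, r => [⟨⟨k, by omega⟩, ⟨k + 1, by omega⟩, r⟩]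

/-- The handleslide marks immediately to the right of a switch (where `σ = τ`) or return, listed
from left to right. Here `C` is the complex prior to the handleslides of the switch or return, and
`r` is the coefficient of the first of these handleslides. -/
def Piece.rightMarks {s t : ℕ} {F : Type*} [Field F] :
    Piece s t → Equiv.Perm (Fin s) → Equiv.Perm (Fin t) → TriComplex F s → F →
      List (Handleslide F t)
  | .crossing (s := s) k hk, σ, τ, C, r =>
      let p : Fin s := ⟨k, by omega⟩
      let q : Fin s := ⟨k + 1, hk⟩
      if σ = τ then
        if DisjointDisks σ p q then
          [⟨p, q, -r⁻¹⟩]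
        else if NestedAbove σ p q then
          -- outer disk bounded by `σ q` and `q`, inner disk bounded by `σ p` and `p`
          let a := C.coeff (σ q) q
          let b := C.coeff (σ p) p
          [⟨p, q, -r⁻¹⟩, ⟨σ q, σ p, a * r⁻¹ * b⁻¹⟩]
        else
          -- outer disk bounded by `p` and `σ p`, inner disk bounded by `q` and `σ q`
          let a := C.coeff p (σ p)
          let b := C.coeff q (σ q)
          [⟨p, q, -r⁻¹⟩, ⟨σ q, σ p, a * r⁻¹ * b⁻¹⟩]
      else
        if DisjointDisks τ p q then
          []
        else if NestedAbove τ p q then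
          -- before the return, upper disk bounded by `σ p` and `p`, lower one by `σ q` and `q`
          let a := C.coeff (σ p) p
          let b := C.coeff (σ q) q
          [⟨τ q, τ p, a * r * b⁻¹⟩]
        else
          -- before the return, upper disk bounded by `p` and `σ p`, lower one by `q` and `σ q`
          let a := C.coeff p (σ p)
          let b := C.coeff q (σ q)
          [⟨τ q, τ p, a⁻¹ * r * b⟩]
  | _, _, _, _, _ => []

namespace FrontDiagram.MCS

variable {D : FrontDiagram} {M : D.MarkedPoints} {F : Type*} [Field F] {N m : ℕ}
  (C : D.MCS M F) (ρ : D.NormalRuling) (μ : D.MaslovPotential N) (hm : m ∣ N)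

/-- The handleslide marks required to the left of the `i`-th event: there is one at switches,
`m`-graded returns and, if `m = 1`, right cusps. -/
def marksBefore (r : Fin D.numEvents → F) (i : Fin D.numEvents) :
    List (Handleslide F (D.strands i.castSucc)) :=
  if ρ.IsSwitch i ∨ ρ.IsGradedReturnOrCusp μ hm i then (D.piece i).leftMarks (r i) else []

/-- The handleslide marks required to the right of the `i`-th event. -/
def marksAfter (r : Fin D.numEvents → F) (i : Fin D.numEvents) :
    List (Handleslide F (D.strands i.succ)) :=
  if ρ.IsSwitch i ∨ ρ.IsGradedReturnOrCusp μ hm i then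
    (D.piece i).rightMarks (ρ.pairing i.castSucc) (ρ.pairing i.succ) (C.beforeLast i.castSucc) (r i)
  else []

/-- The handleslide set consists exactly of the handleslides prescribed near switches, `m`-graded
returns and (if `m = 1`) right cusps, where the first handleslide at the `i`-th event, if it is one
of these, has coefficient `r i`: the marks over each strip are those which belong to the event at
its left end followed by those which belong to the event at its right end. -/
def HasSRMarks (r : Fin D.numEvents → F) : Prop :=
  ∀ i : Fin (D.numEvents + 1),
    C.marks i =
      Fin.cases (motive := fun i => List (Handleslide F (D.strands i))) []
        (C.marksAfter ρ μ hm r) i ++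
      Fin.lastCases (motive := fun i => List (Handleslide F (D.strands i))) []
        (marksBefore ρ μ hm r) i

/-- `C` is an `m`-graded Morse complex sequence in SR-form compatible with `ρ`. -/
def IsSRForm : Prop :=
  C.IsGraded μ hm ∧ C.HasSimpleLeftCusps ∧
    ∃ r : Fin D.numEvents → F, (∀ i, ρ.IsSwitch i → r i ≠ 0) ∧ C.HasSRMarks ρ μ hm r

end FrontDiagram.MCS

/-- The first handleslide coefficients determined by a point `(t, x, z)`: at a switch `j` it is
`x j`, except for type S3, where it is `-x j`; at `m`-graded returns and (if `m = 1`) right cusps it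
is the corresponding coordinate of `z`. The value `0` at other events plays no role. -/
def FrontDiagram.NormalRuling.firstCoeff {D : FrontDiagram} {N m : ℕ} (ρ : D.NormalRuling)
    (μ : D.MaslovPotential N) (hm : m ∣ N) {F : Type*} [Field F] (P : ρ.ParamSpace μ hm F)
    (i : Fin D.numEvents) : F :=
  if h : ρ.IsSwitch i then
    if (D.piece i).IsNestedBelow (ρ.pairing i.castSucc) then -(P.2.1 ⟨i, h⟩ : F)
    else (P.2.1 ⟨i, h⟩ : F)
  else if h : ρ.IsGradedReturnOrCusp μ hm i then P.2.2 ⟨i, h⟩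
  else 0

end Legendrian

end

/-!
# Morse complex sequences in SR-form and the disk equations of a normal ruling

The point is that, away from the crossings, the complexes of a Morse complex sequence in SR-form are
*standard* with respect to the ruling `ρ`: the differential maps the upper strand of each pair to a
multiple of the lower one and vanishes on lower strands (`stdComplex`). The multiple is attached to
the disk bounded by the two strands. It is `1` after a simple left cusp, and the handleslides around
a crossing are chosen so that the complex is standard again after them. At crossings which are not
switches the coefficients of the disks do not change; at a switch the two disks involved pick up
exactly the factors `-x`, `x` or `x⁻¹` which appear in the disk equations
(`Piece.complexStep_stdComplex`, which rests on one explicit chain map for each type of switch and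
return). So the coefficient of a disk over a strip is the product of its factors at the switches on
the left of the strip (`diskCoeff`, `coeffStep_diskCoeff`), and before the right cusp of the disk it
is the full left-hand side of its disk equation (`diskCoeff_eq_diskProduct`). The requirement of a
Morse complex sequence at this right cusp, namely that the coefficient is `-1` or `-t_k`, is
therefore the disk equation. This gives a sequence `srForm P` for each solution `P`.

Conversely, at each event the complex on the right is determined by the one on the left
(`Piece.ComplexStep.unique`; at left cusps this uses simplicity), so that an SR-form is determined
by its first handleslide coefficients (`Compatible.rigid`). Since the latter can be read off from
the marks (`HasSRMarks.coeff_unique`), `P ↦ srForm P` is injective, and it is surjective because the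
coefficients of an arbitrary SR-form before right cusps are the products in the disk equations.

The combinatorial input is that a disk meets a strip in at most one pair of strands, begins at one
left cusp and ends at one right cusp, although disks are defined as classes of the equivalence
relation generated by adjacency along their boundary. It is obtained from the function `start`,
which records the left cusp at which a disk begins, is constant on disks, and separates the disks
over each strip.
-/

noncomputable section

namespace Legendrian

variable {F : Type*} [Field F] {s t u : ℕ}

/-! ### Linear maps on free modules with a basis of strands -/

@[simp]
theorem onBasis_single (f : Fin s → (Fin t → F)) (i : Fin s) :
    onBasis f (Pi.single i 1) = f i := by
  have := (Pi.basisFun F (Fin s)).constr_basis F f i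
  rwa [Pi.basisFun_apply] at this

theorem linearMap_ext_single {f g : (Fin s → F) →ₗ[F] (Fin t → F)}
    (h : ∀ i, f (Pi.single i 1) = g (Pi.single i 1)) : f = g :=
  (Pi.basisFun F (Fin s)).ext fun i => by simpa using h i

theorem onBasis_skip_apply (k : ℕ) (v : Fin s → F) :
    onBasis (fun i => (Pi.single (skip k i) 1 : Fin (s + 2) → F)) v =
      ∑ i, v i • Pi.single (skip k i) 1 := by
  simp [onBasis, Module.Basis.constr_apply_fintype]

/-- All nonzero matrix entries of `f` are at positions satisfying `r`. -/
def SupportedOn (f : (Fin s → F) →ₗ[F] (Fin t → F)) (r : Fin s → Fin t → Prop) : Prop :=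
  ∀ j k, f (Pi.single j 1) k ≠ 0 → r j k

theorem SupportedOn.comp {f : (Fin s → F) →ₗ[F] (Fin t → F)} {g : (Fin t → F) →ₗ[F] (Fin u → F)}
    {r : Fin s → Fin t → Prop} {r' : Fin t → Fin u → Prop} {r'' : Fin s → Fin u → Prop}
    (hg : SupportedOn g r') (hf : SupportedOn f r) (h : ∀ i j k, r i j → r' j k → r'' i k) :
    SupportedOn (g ∘ₗ f) r'' := by
  intro i k hik
  rw [LinearMap.comp_apply, LinearMap.pi_apply_eq_sum_univ g, Finset.sum_apply] at hik
  obtain ⟨j, -, hj⟩ := Finset.exists_ne_zero_of_sum_ne_zero hik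
  simp only [Pi.smul_apply, smul_eq_mul, ne_eq, mul_eq_zero, not_or] at hj
  refine h i j k (hf i j hj.1) (hg j k ?_)
  have e : (Pi.single j 1 : Fin t → F) = fun l => if j = l then 1 else 0 := by
    ext l; simp [Pi.single_apply, eq_comm]
  rw [e]; exact hj.2

theorem TriComplex.supportedOn_lt (C : TriComplex F s) : SupportedOn C.d (· < ·) := by
  intro j k h
  by_contra hjk
  exact h (C.triangular j k hjk)

theorem TriComplex.d_d (C : TriComplex F s) (v : Fin s → F) : C.d (C.d v) = 0 :=
  LinearMap.congr_fun C.d_sq v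

/-! ### Handleslides acting on complexes -/

@[simp]
theorem Handleslide.map_single (h : Handleslide F s) (i : Fin s) :
    h.map (Pi.single i 1) = if i = h.upper then
      Pi.single h.upper 1 - h.coeff • Pi.single h.lower 1 else Pi.single i 1 := by
  simp [Handleslide.map]

/-- The handleslide with the opposite coefficient. -/
def Handleslide.neg (h : Handleslide F s) : Handleslide F s := ⟨h.upper, h.lower, -h.coeff⟩

@[simp] theorem Handleslide.neg_upper (h : Handleslide F s) : h.neg.upper = h.upper := rfl
@[simp] theorem Handleslide.neg_lower (h : Handleslide F s) : h.neg.lower = h.lower := rfl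
@[simp] theorem Handleslide.neg_coeff (h : Handleslide F s) : h.neg.coeff = -h.coeff := rfl
@[simp] theorem Handleslide.neg_neg (h : Handleslide F s) : h.neg.neg = h := by
  ext <;> simp

theorem Handleslide.map_comp_neg (h : Handleslide F s) (hlt : h.upper < h.lower) :
    h.map ∘ₗ h.neg.map = LinearMap.id := by
  apply linearMap_ext_single
  intro i
  by_cases hi : i = h.upper
  · simp [hi, hlt.ne']
  · simp [hi]

theorem Handleslide.neg_comp_map (h : Handleslide F s) (hlt : h.upper < h.lower) :
    h.neg.map ∘ₗ h.map = LinearMap.id := by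
  simpa using h.neg.map_comp_neg hlt

theorem Handleslide.map_neg_apply (h : Handleslide F s) (hlt : h.upper < h.lower) (v : Fin s → F) :
    h.map (h.neg.map v) = v :=
  LinearMap.congr_fun (h.map_comp_neg hlt) v

theorem Handleslide.neg_map_apply (h : Handleslide F s) (hlt : h.upper < h.lower) (v : Fin s → F) :
    h.neg.map (h.map v) = v :=
  LinearMap.congr_fun (h.neg_comp_map hlt) v

theorem Handleslide.map_bijective (h : Handleslide F s) (hlt : h.upper < h.lower) :
    Function.Bijective h.map :=
  Function.bijective_iff_has_inverse.2
    ⟨h.neg.map, h.neg_map_apply hlt, h.map_neg_apply hlt⟩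

theorem Handleslide.supportedOn_map (h : Handleslide F s) {r : Fin s → Fin s → Prop}
    (hr : ∀ i, r i i) (hh : r h.upper h.lower) : SupportedOn h.map r := by
  intro i k hik
  rw [Handleslide.map_single] at hik
  split_ifs at hik with hi
  · subst hi
    by_cases h1 : k = h.upper
    · rw [h1]; exact hr _
    by_cases h2 : k = h.lower
    · rw [h2]; exact hh
    · simp [h1, h2] at hik
  · by_cases h1 : k = i
    · rw [h1]; exact hr _
    · simp [h1] at hik

/-- The complex on the right of a handleslide mark, given the complex `C` on its left: the
differential is conjugated by the handleslide map. If the endpoints of the mark are not in the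
correct order, the value is `C`. -/
def slide (h : Handleslide F s) (C : TriComplex F s) : TriComplex F s :=
  if hlt : h.upper < h.lower then
    { d := h.map ∘ₗ C.d ∘ₗ h.neg.map
      d_sq := by
        apply LinearMap.ext
        intro v
        simp [h.neg_map_apply hlt, C.d_d]
      triangular := by
        intro j k hjk
        by_contra hne
        refine hjk (SupportedOn.comp (r := (· < ·)) (r' := (· ≤ ·)) (r'' := (· < ·))
          ?_ ?_ ?_ j k hne)
        · exact h.supportedOn_map (fun _ => le_rfl) hlt.le
        · exact C.supportedOn_lt.comp (h.neg.supportedOn_map (fun _ => le_rfl) hlt.le)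
            fun _ _ _ => lt_of_le_of_lt
        · exact fun _ _ _ => lt_of_lt_of_le }
  else C

theorem slide_d (h : Handleslide F s) (hlt : h.upper < h.lower) (C : TriComplex F s) :
    (slide h C).d = h.map ∘ₗ C.d ∘ₗ h.neg.map := by
  simp [slide, hlt]

theorem isComplexIso_slide (h : Handleslide F s) (hlt : h.upper < h.lower) (C : TriComplex F s) :
    IsComplexIso C (slide h C) h.map := by
  refine ⟨h.map_bijective hlt, LinearMap.ext fun v => ?_⟩
  simp [slide_d h hlt, h.neg_map_apply hlt]

theorem IsComplexIso.unique {C : TriComplex F s} {C' C'' : TriComplex F t}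
    {φ : (Fin s → F) →ₗ[F] (Fin t → F)} (h : IsComplexIso C C' φ) (h' : IsComplexIso C C'' φ) :
    C' = C'' := by
  ext1
  apply LinearMap.ext
  intro v
  obtain ⟨w, rfl⟩ := h.1.2 v
  exact LinearMap.congr_fun (h.2.symm.trans h'.2) w

theorem slide_neg_slide (h : Handleslide F s) (C : TriComplex F s) :
    slide h.neg (slide h C) = C := by
  by_cases hlt : h.upper < h.lower
  · ext1
    apply LinearMap.ext
    intro v
    simp [slide_d _ hlt, slide_d h.neg (C := slide h C) hlt, h.neg_map_apply hlt]
  · simp [slide, hlt]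

theorem slide_slide_neg (h : Handleslide F s) (C : TriComplex F s) :
    slide h (slide h.neg C) = C := by
  simpa using slide_neg_slide h.neg C

/-- The complex on the right of a sequence of handleslide marks, given the complex on its left. -/
def slides (L : List (Handleslide F s)) (C : TriComplex F s) : TriComplex F s :=
  L.foldl (fun C h => slide h C) C

/-- The complex on the left of a sequence of handleslide marks, given the complex on its right. -/
def unslides (L : List (Handleslide F s)) (C : TriComplex F s) : TriComplex F s :=
  L.foldr (fun h C => slide h.neg C) C

@[simp] theorem unslides_nil (C : TriComplex F s) : unslides [] C = C := rfl

@[simp] theorem slides_cons (h : Handleslide F s) (L : List (Handleslide F s))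
    (C : TriComplex F s) : slides (h :: L) C = slides L (slide h C) := rfl

@[simp] theorem unslides_cons (h : Handleslide F s) (L : List (Handleslide F s))
    (C : TriComplex F s) : unslides (h :: L) C = slide h.neg (unslides L C) := rfl

theorem slides_append (L L' : List (Handleslide F s)) (C : TriComplex F s) :
    slides (L ++ L') C = slides L' (slides L C) := by
  simp [slides]

@[simp]
theorem slides_unslides (L : List (Handleslide F s)) (C : TriComplex F s) :
    slides L (unslides L C) = C := by
  induction L generalizing C with
  | nil => rfl
  | cons h L ih => simp [slide_slide_neg, ih]

/-- The composition of the handleslide maps of a sequence of marks. -/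
def slidesMap : List (Handleslide F s) → (Fin s → F) →ₗ[F] (Fin s → F)
  | [] => LinearMap.id
  | h :: L => slidesMap L ∘ₗ h.map

theorem IsComplexIso.comp {C : TriComplex F s} {C' : TriComplex F t} {C'' : TriComplex F u}
    {φ : (Fin s → F) →ₗ[F] (Fin t → F)} {ψ : (Fin t → F) →ₗ[F] (Fin u → F)}
    (hψ : IsComplexIso C' C'' ψ) (hφ : IsComplexIso C C' φ) : IsComplexIso C C'' (ψ ∘ₗ φ) := by
  refine ⟨hψ.1.comp hφ.1, ?_⟩
  rw [LinearMap.comp_assoc, hφ.2, ← LinearMap.comp_assoc, hψ.2, LinearMap.comp_assoc]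

theorem isComplexIso_slides (L : List (Handleslide F s)) (hL : ∀ h ∈ L, h.upper < h.lower)
    (C : TriComplex F s) : IsComplexIso C (slides L C) (slidesMap L) := by
  induction L generalizing C with
  | nil => exact ⟨Function.bijective_id, rfl⟩
  | cons h L ih =>
    exact (ih (fun h' hh' => hL h' (List.mem_cons_of_mem _ hh')) _).comp
      (isComplexIso_slide h (hL h List.mem_cons_self) C)

/-- To check that `φ` is an isomorphism between the complexes obtained by moving `C` to the right
across the marks `L` and `C'` to the left across the marks `L'`, it suffices to look at the composed
map from `C` to `C'`. -/
theorem isComplexIso_slides_unslides {L : List (Handleslide F s)} {L' : List (Handleslide F t)}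
    (hL : ∀ h ∈ L, h.upper < h.lower) (hL' : ∀ h ∈ L', h.upper < h.lower)
    {C : TriComplex F s} {C' : TriComplex F t} {φ : (Fin s → F) →ₗ[F] (Fin t → F)}
    (hφ : Function.Bijective φ)
    (h : ∀ i, slidesMap L' (φ (slidesMap L (C.d (Pi.single i 1)))) =
      C'.d (slidesMap L' (φ (slidesMap L (Pi.single i 1))))) :
    IsComplexIso (slides L C) (unslides L' C') φ := by
  have h1 := isComplexIso_slides L hL C
  have h2 := isComplexIso_slides L' hL' (unslides L' C')
  rw [slides_unslides] at h2
  have h3 : slidesMap L' ∘ₗ φ ∘ₗ slidesMap L ∘ₗ C.d = C'.d ∘ₗ slidesMap L' ∘ₗ φ ∘ₗ slidesMap L :=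
    linearMap_ext_single h
  refine ⟨hφ, LinearMap.ext fun v => ?_⟩
  obtain ⟨w, rfl⟩ := h1.1.2 v
  apply h2.1.1
  have e1 := LinearMap.congr_fun h1.2 w
  have e2 := LinearMap.congr_fun h2.2 (φ (slidesMap L w))
  have e3 := LinearMap.congr_fun h3 w
  simp only [LinearMap.comp_apply] at e1 e2 e3 ⊢
  rw [← e1, e3, e2]

/-! ### Graded complexes -/

/-- The differential has degree `-1` for the grading `g` of the strands. -/
def TriComplex.IsGradedBy {A : Type*} [AddGroup A] [One A] (C : TriComplex F s) (g : Fin s → A) :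
    Prop :=
  ∀ j k, C.coeff j k ≠ 0 → g k = g j - 1

theorem TriComplex.IsGradedBy.slide {A : Type*} [AddGroup A] [One A] {C : TriComplex F s}
    {g : Fin s → A} (hC : C.IsGradedBy g) {h : Handleslide F s} (hg : g h.upper = g h.lower) :
    (slide h C).IsGradedBy g := by
  by_cases hlt : h.upper < h.lower
  · intro j k hjk
    rw [TriComplex.coeff, slide_d h hlt] at hjk
    refine SupportedOn.comp (r := fun j k => g k = g j - 1) (r' := fun j k => g j = g k)
      (r'' := fun j k => g k = g j - 1) ?_ ?_ ?_ j k hjk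
    · exact h.supportedOn_map (fun _ => rfl) hg
    · refine SupportedOn.comp (r := fun j k => g j = g k) hC
        (h.neg.supportedOn_map (fun _ => rfl) hg) fun i j k h1 h2 => ?_
      rw [h2, h1]
    · intro i j k h1 h2
      rw [← h2, h1]
  · simpa [Legendrian.slide, hlt] using hC

theorem TriComplex.IsGradedBy.slides {A : Type*} [AddGroup A] [One A] {g : Fin s → A}
    {L : List (Handleslide F s)} (hg : ∀ h ∈ L, g h.upper = g h.lower) {C : TriComplex F s}
    (hC : C.IsGradedBy g) : (slides L C).IsGradedBy g := by
  induction L generalizing C with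
  | nil => exact hC
  | cons h L ih =>
    exact ih (fun h' hh' => hg h' (List.mem_cons_of_mem _ hh')) (hC.slide (hg h List.mem_cons_self))

theorem TriComplex.IsGradedBy.unslides {A : Type*} [AddGroup A] [One A] {g : Fin s → A}
    {L : List (Handleslide F s)} (hg : ∀ h ∈ L, g h.upper = g h.lower) {C : TriComplex F s}
    (hC : C.IsGradedBy g) : (unslides L C).IsGradedBy g := by
  induction L with
  | nil => exact hC
  | cons h L ih =>
    exact (ih fun h' hh' => hg h' (List.mem_cons_of_mem _ hh')).slide (h := h.neg)
      (hg h List.mem_cons_self)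

/-! ### Standard complexes of fixed-point free involutions -/

/-- The standard complex of an involution `σ` of the strands with coefficients `a`: the
differential maps the upper strand `e_p` of a pair to `a p` times the lower strand `e_{σ p}`, and
the lower strand to `0`. -/
def stdComplex (σ : Equiv.Perm (Fin s)) (hσ : ∀ p, σ (σ p) = p) (a : Fin s → Fˣ) :
    TriComplex F s where
  d := onBasis fun p => if p < σ p then (a p : F) • Pi.single (σ p) 1 else 0
  d_sq := by
    apply linearMap_ext_single
    intro p
    by_cases hp : p < σ p
    · simp [hp, hσ, hp.le]
    · simp [hp]
  triangular := by
    intro j k hjk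
    by_cases hp : j < σ j
    · have : k ≠ σ j := by rintro rfl; exact hjk hp
      simp [hp, this]
    · simp [hp]

theorem stdComplex_single {σ : Equiv.Perm (Fin s)} (hσ : ∀ p, σ (σ p) = p) (a : Fin s → Fˣ)
    (p : Fin s) : (stdComplex σ hσ a).d (Pi.single p 1) =
      if p < σ p then (a p : F) • Pi.single (σ p) 1 else 0 := by
  simp [stdComplex]

theorem stdComplex_coeff {σ : Equiv.Perm (Fin s)} (hσ : ∀ p, σ (σ p) = p) (a : Fin s → Fˣ)
    {p : Fin s} (hp : p < σ p) : (stdComplex σ hσ a).coeff p (σ p) = a p := by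
  simp [TriComplex.coeff, stdComplex_single, hp]

theorem stdComplex_coeff' {σ : Equiv.Perm (Fin s)} (hσ : ∀ p, σ (σ p) = p) (a : Fin s → Fˣ)
    {p : Fin s} (hp : σ p < p) : (stdComplex σ hσ a).coeff (σ p) p = a (σ p) := by
  have := stdComplex_coeff hσ a (p := σ p) (by rwa [hσ])
  rwa [hσ] at this

theorem stdComplex_isGradedBy {A : Type*} [AddGroup A] [One A] {σ : Equiv.Perm (Fin s)}
    (hσ : ∀ p, σ (σ p) = p) (a : Fin s → Fˣ) {g : Fin s → A}
    (hg : ∀ p, p < σ p → g (σ p) = g p - 1) : (stdComplex σ hσ a).IsGradedBy g := by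
  intro j k hjk
  rw [TriComplex.coeff, stdComplex_single] at hjk
  split_ifs at hjk with hj
  · by_cases hk : k = σ j
    · rw [hk]; exact hg j hj
    · simp [hk] at hjk
  · simp at hjk

/-- A handleslide between paired strands does not change a standard complex. -/
theorem slide_stdComplex_of_paired {σ : Equiv.Perm (Fin s)} (hσ : ∀ p, σ (σ p) = p)
    (a : Fin s → Fˣ) {h : Handleslide F s} (hlt : h.upper < h.lower) (hh : σ h.upper = h.lower) :
    slide h (stdComplex σ hσ a) = stdComplex σ hσ a := by
  refine (isComplexIso_slide h hlt _).unique ⟨h.map_bijective hlt, ?_⟩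
  have hl : σ h.lower = h.upper := by rw [← hh, hσ]
  apply linearMap_ext_single
  intro p
  by_cases hp : p = h.upper
  · simp [stdComplex_single, hp, hh, hlt, hl, hlt.not_gt, hlt.ne']
  · by_cases hp2 : p = h.lower
    · simp [stdComplex_single, hp2, hl, hlt.not_gt, hlt.ne']
    · have : σ p ≠ h.upper := fun e => hp2 (by rw [← hh, ← e, hσ])
      simp only [LinearMap.comp_apply, stdComplex_single, Handleslide.map_single, hp, if_false]
      split_ifs <;> simp [this]

/-! ### Complexes at cusps -/

theorem skip_injective (k : ℕ) : Function.Injective (skip k : Fin s → Fin (s + 2)) := by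
  intro p q h
  unfold skip at h
  ext
  split_ifs at h <;> simp only [Fin.mk.injEq] at h <;> omega

theorem skip_val (k : ℕ) (p : Fin s) :
    (skip k p : ℕ) = if (p : ℕ) < k then (p : ℕ) else p + 2 := by
  unfold skip; split_ifs <;> rfl

theorem skip_val_ne (k : ℕ) (p : Fin s) : (skip k p : ℕ) ≠ k ∧ (skip k p : ℕ) ≠ k + 1 := by
  rw [skip_val]; split_ifs <;> omega

theorem skip_lt_skip (k : ℕ) {p q : Fin s} : skip k p < skip k q ↔ p < q := by
  rw [Fin.lt_def, Fin.lt_def, skip_val, skip_val]; split_ifs <;> omega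

theorem exists_skip_eq {k : ℕ} {q : Fin (s + 2)} (h : (q : ℕ) ≠ k) (h' : (q : ℕ) ≠ k + 1)
    (hk : k ≤ s) : ∃ p : Fin s, q = skip k p := by
  by_cases hq : (q : ℕ) < k
  · refine ⟨⟨q, by omega⟩, ?_⟩
    ext; simp [skip_val, hq]
  · refine ⟨⟨q - 2, by omega⟩, ?_⟩
    ext
    rw [skip_val, if_neg (by simp only; omega)]
    simp only; omega

theorem onBasis_skip_apply_skip (k : ℕ) (v : Fin s → F) (p : Fin s) :
    onBasis (fun i => (Pi.single (skip k i) 1 : Fin (s + 2) → F)) v (skip k p) = v p := by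
  rw [onBasis_skip_apply, Finset.sum_apply]
  simp [Pi.single_apply, (skip_injective k).eq_iff]

theorem onBasis_skip_apply_of_ne (k : ℕ) (v : Fin s → F) {q : Fin (s + 2)}
    (hq : ∀ p : Fin s, q ≠ skip k p) :
    onBasis (fun i => (Pi.single (skip k i) 1 : Fin (s + 2) → F)) v q = 0 := by
  rw [onBasis_skip_apply, Finset.sum_apply]
  simp [hq]

/-- If `d e_k` is a unit multiple of `e_{k+1}`, the subcomplex spanned by `e_k` and `d e_k` consists
of the vectors supported on the strands `k`, `k + 1`. -/
theorem mem_span_cusp {k : ℕ} (hk : k ≤ s) {S : TriComplex F (s + 2)} {c : F} (hc : c ≠ 0)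
    (hS : S.d (Pi.single ⟨k, by omega⟩ 1) = c • Pi.single ⟨k + 1, by omega⟩ 1)
    (v : Fin (s + 2) → F) :
    v ∈ Submodule.span F {(Pi.single ⟨k, by omega⟩ 1 : Fin (s + 2) → F),
      S.d (Pi.single ⟨k, by omega⟩ 1)} ↔ ∀ p, v (skip k p) = 0 := by
  rw [hS, Submodule.mem_span_pair]
  have hne : ∀ p : Fin s, skip k p ≠ ⟨k, by omega⟩ ∧ skip k p ≠ ⟨k + 1, by omega⟩ := fun p =>
    ⟨fun e => (skip_val_ne k p).1 (congrArg Fin.val e),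
      fun e => (skip_val_ne k p).2 (congrArg Fin.val e)⟩
  constructor
  · rintro ⟨x, y, rfl⟩ p
    simp [hne]
  · intro h
    refine ⟨v ⟨k, by omega⟩, v ⟨k + 1, by omega⟩ * c⁻¹, ?_⟩
    ext q
    by_cases h1 : (q : ℕ) = k
    · rw [show q = ⟨k, by omega⟩ from Fin.ext h1]
      simp
    by_cases h2 : (q : ℕ) = k + 1
    · rw [show q = ⟨k + 1, by omega⟩ from Fin.ext h2]
      simp [hc]
    obtain ⟨p, rfl⟩ := exists_skip_eq h1 h2 hk
    simp [hne, h]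

theorem isCuspQuotient_of_commute {k : ℕ} (hk : k ≤ s) {S : TriComplex F (s + 2)}
    {C : TriComplex F s} {c : F} (hc : c ≠ 0)
    (hS : S.d (Pi.single ⟨k, by omega⟩ 1) = c • Pi.single ⟨k + 1, by omega⟩ 1)
    (h : ∀ p, onBasis (fun i => (Pi.single (skip k i) 1 : Fin (s + 2) → F)) (C.d (Pi.single p 1)) =
      S.d (Pi.single (skip k p) 1)) : IsCuspQuotient k hk S C := by
  refine ⟨⟨?_, ?_⟩, ?_⟩
  · rw [← LinearMap.ker_eq_bot, LinearMap.ker_eq_bot']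
    intro v hv
    rw [LinearMap.comp_apply, Submodule.mkQ_apply, Submodule.Quotient.mk_eq_zero,
      mem_span_cusp hk hc hS] at hv
    ext p
    simpa [onBasis_skip_apply_skip] using hv p
  · intro w
    obtain ⟨w, rfl⟩ := Submodule.mkQ_surjective _ w
    refine ⟨fun p => w (skip k p), ?_⟩
    rw [LinearMap.comp_apply, ← sub_eq_zero, ← map_sub, Submodule.mkQ_apply,
      Submodule.Quotient.mk_eq_zero, mem_span_cusp hk hc hS]
    intro p
    simp [onBasis_skip_apply_skip]
  · refine (Pi.basisFun F (Fin s)).ext fun p => ?_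
    simp [h]

/-- A complex on the right of a right cusp is determined by the complex on its left. -/
theorem IsCuspQuotient.unique_right {k : ℕ} {hk : k ≤ s} {S : TriComplex F (s + 2)}
    {C C' : TriComplex F s} (h : IsCuspQuotient k hk S C) (h' : IsCuspQuotient k hk S C') :
    C = C' := by
  ext1
  apply LinearMap.ext
  intro v
  apply h.1.1
  exact LinearMap.congr_fun (h.2.trans h'.2.symm) v

/-- The complex on the right of a simple left cusp is determined by the complex on its left. -/
theorem IsCuspQuotient.unique_left {k : ℕ} {hk : k ≤ s} {S S' : TriComplex F (s + 2)}
    {C : TriComplex F s} (h : IsCuspQuotient k hk S C) (h' : IsCuspQuotient k hk S' C)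
    (hS : (Piece.leftCusp k hk).LeftCuspSimple S) (hS' : (Piece.leftCusp k hk).LeftCuspSimple S') :
    S = S' := by
  have key : ∀ T : TriComplex F (s + 2), IsCuspQuotient k hk T C →
      (Piece.leftCusp k hk).LeftCuspSimple T →
      ∀ p, T.d (Pi.single (skip k p) 1) =
        onBasis (fun i => (Pi.single (skip k i) 1 : Fin (s + 2) → F)) (C.d (Pi.single p 1)) := by
    intro T hT ⟨hs1, hs2⟩ p
    have e := LinearMap.congr_fun hT.2 (Pi.single p 1)
    simp only [LinearMap.comp_apply, onBasis_single] at e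
    rw [eq_comm, ← sub_eq_zero, ← map_sub, Submodule.mkQ_apply, Submodule.Quotient.mk_eq_zero,
      mem_span_cusp hk one_ne_zero (by simpa using hs1)] at e
    have hz : ∀ q : Fin (s + 2), ((q : ℕ) = k ∨ (q : ℕ) = k + 1) →
        T.d (Pi.single (skip k p) 1) q = 0 := by
      intro q hq
      by_cases hp : (skip k p : ℕ) < k
      · have := hs2 _ hp
        rcases hq with hq | hq
        · rw [show q = ⟨k, by omega⟩ from Fin.ext hq]; exact this.1
        · rw [show q = ⟨k + 1, by omega⟩ from Fin.ext hq]; exact this.2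
      · apply T.triangular
        have := skip_val_ne k p
        rw [Fin.lt_def]
        omega
    ext q
    by_cases hq : (q : ℕ) = k ∨ (q : ℕ) = k + 1
    · rw [hz q hq, onBasis_skip_apply_of_ne]
      rintro p rfl
      have := skip_val_ne k p
      omega
    · push Not at hq
      obtain ⟨p', rfl⟩ := exists_skip_eq hq.1 hq.2 hk
      have := e p'
      rwa [Pi.sub_apply, sub_eq_zero] at this
  ext1
  apply linearMap_ext_single
  intro q
  by_cases h1 : (q : ℕ) = k
  · rw [show q = ⟨k, by omega⟩ from Fin.ext h1]
    rw [hS.1, hS'.1]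
  by_cases h2 : (q : ℕ) = k + 1
  · rw [show q = ⟨k + 1, by omega⟩ from Fin.ext h2]
    rw [← hS.1, S.d_d, hS.1, ← hS'.1, S'.d_d]
  obtain ⟨p, rfl⟩ := exists_skip_eq h1 h2 hk
  rw [key S h hS, key S' h' hS']

/-! ### Standard complexes at crossings

Near a switch or return, the composition `M` of the handleslide maps before the crossing, the
exchange of the crossing strands, and the handleslide maps after the crossing is a chain map between
standard complexes. In this part `A`, `B` are the crossing strands, `u`, `v` their companions before
the crossing, and `r` is the coefficient of the first handleslide. -/

section Crossing

variable {σ τ : Equiv.Perm (Fin s)} {A B u v : Fin s} {a a' : Fin s → Fˣ}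
  {M : (Fin s → F) →ₗ[F] (Fin s → F)} {r : F}

theorem swap_lt_swap_iff (hAB : (B : ℕ) = A + 1) {i j : Fin s} (hij : i ≠ j)
    (h : ¬ (i = A ∧ j = B)) (h' : ¬ (i = B ∧ j = A)) :
    Equiv.swap A B i < Equiv.swap A B j ↔ i < j := by
  simp only [Equiv.swap_apply_def]
  simp only [Fin.ext_iff, ne_eq] at h h' hij ⊢
  simp only [Fin.lt_def]
  split_ifs <;> omega

/-- At a crossing which is not a switch, exchanging the crossing strands maps a standard complex to
a standard complex. -/
theorem plain_crossing_commute (hAB : (B : ℕ) = A + 1) (hσ : ∀ p, σ (σ p) = p)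
    (hfix : ∀ p, σ p ≠ p) (hne : σ A ≠ B) (hτ : ∀ p, τ (τ p) = p)
    (hστ : ∀ p, τ (Equiv.swap A B p) = Equiv.swap A B (σ p))
    (ha : ∀ p, a' (Equiv.swap A B p) = a p) (p : Fin s) :
    onBasis (fun i => (Pi.single (Equiv.swap A B i) 1 : Fin s → F))
        ((stdComplex σ hσ a).d (Pi.single p 1)) =
      (stdComplex τ hτ a').d (Pi.single (Equiv.swap A B p) 1) := by
  have h1 : Equiv.swap A B p < Equiv.swap A B (σ p) ↔ p < σ p := by
    refine swap_lt_swap_iff hAB (hfix p).symm ?_ ?_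
    · rintro ⟨rfl, h⟩; exact hne h
    · rintro ⟨rfl, h⟩; exact hne (by rw [← h, hσ])
  rw [stdComplex_single, stdComplex_single, hστ, ha]
  by_cases hp : p < σ p <;> simp [h1, hp]

/-- At a switch of type S1, the coefficient of the upper disk is multiplied by `-r` and that of the
lower disk by `r`. -/
theorem switch_disjoint_commute (hAB : A < B) (hσ : ∀ p, σ (σ p) = p)
    (hu : σ A = u) (hv : σ B = v)
    (h1 : u < A) (h2 : B < v) (hr : r ≠ 0)
    (hMA : M (Pi.single A 1) = -r • Pi.single A 1)
    (hMB : M (Pi.single B 1) = Pi.single A 1 + r⁻¹ • Pi.single B 1)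
    (hM : ∀ p, p ≠ A → p ≠ B → M (Pi.single p 1) = Pi.single p 1)
    (h_au : (a' u : F) = -r * a u) (h_aB : (a' B : F) = r * a B)
    (ha : ∀ p, p ≠ A → p ≠ B → p ≠ u → p ≠ v → a' p = a p) (p : Fin s) :
    M ((stdComplex σ hσ a).d (Pi.single p 1)) =
      (stdComplex σ hσ a').d (M (Pi.single p 1)) := by
  have hu' : σ u = A := by rw [← hu, hσ]
  have hv' : σ v = B := by rw [← hv, hσ]
  have lAv : A < v := by order
  have luB : u < B := by order
  by_cases cA : p = A
  · subst cA
    simp [stdComplex_single, hu, hMA, h1.not_gt]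
  by_cases cB : p = B
  · subst cB
    simp [stdComplex_single, hu, hv, hMB, hM, lAv.ne', h2, h2.ne', h1.not_gt, h_aB]
    match_scalars
    field_simp
  by_cases cu : p = u
  · subst cu
    simp [stdComplex_single, hu', hMA, hM, h1, h1.ne, luB.ne, h_au]
    module
  by_cases cv : p = v
  · subst cv
    simp [stdComplex_single, hv', hM, lAv.ne', h2.ne', h2.not_gt]
  have o1 : σ p ≠ A := fun e => cu (by rw [← hu, ← e, hσ])
  have o2 : σ p ≠ B := fun e => cv (by rw [← hv, ← e, hσ])
  by_cases hp : p < σ p <;> simp [stdComplex_single, hM, cA, cB, cu, cv, o1, o2, hp, ha]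

/-- At a switch of type S2, the coefficient of the inner disk is multiplied by `-r` and that of the
outer disk by `r⁻¹`. The handleslide between the companions cancels the component `a v • e_A` of the
new differential of `e_v`. -/
theorem switch_nestedAbove_commute (hAB : A < B) (hσ : ∀ p, σ (σ p) = p)
    (hu : σ A = u) (hv : σ B = v)
    (h1 : v < u) (h2 : u < A) (hr : r ≠ 0)
    (hMA : M (Pi.single A 1) = -r • Pi.single A 1)
    (hMB : M (Pi.single B 1) = Pi.single A 1 + r⁻¹ • Pi.single B 1)
    (hMc : M (Pi.single v 1) = Pi.single v 1 - ((a v : F) * r⁻¹ * (a u : F)⁻¹) • Pi.single u 1)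
    (hM : ∀ p, p ≠ A → p ≠ B → p ≠ v → M (Pi.single p 1) = Pi.single p 1)
    (h_au : (a' u : F) = -r * a u) (h_av : (a' v : F) = r⁻¹ * a v)
    (ha : ∀ p, p ≠ A → p ≠ B → p ≠ u → p ≠ v → a' p = a p) (p : Fin s) :
    M ((stdComplex σ hσ a).d (Pi.single p 1)) =
      (stdComplex σ hσ a').d (M (Pi.single p 1)) := by
  have hu' : σ u = A := by rw [← hu, hσ]
  have hv' : σ v = B := by rw [← hv, hσ]
  have luB : u < B := by order
  have lvB : v < B := by order
  by_cases cA : p = A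
  · subst cA
    simp [stdComplex_single, hu, hMA, h2.not_gt]
  by_cases cB : p = B
  · subst cB
    simp [stdComplex_single, hu, hv, hMB, h2.not_gt, lvB.not_gt]
  by_cases cu : p = u
  · subst cu
    simp [stdComplex_single, hu', hMA, hM, h2, h2.ne, luB.ne, h1.ne', h_au]
    module
  by_cases cv : p = v
  · subst cv
    simp [stdComplex_single, hu', hv', hMB, hMc, h2, lvB, h_au, h_av]
    match_scalars <;> field_simp
  have o1 : σ p ≠ A := fun e => cu (by rw [← hu, ← e, hσ])
  have o2 : σ p ≠ B := fun e => cv (by rw [← hv, ← e, hσ])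
  have o4 : σ p ≠ v := fun e => cB (by rw [← hv', ← e, hσ])
  by_cases hp : p < σ p <;> simp [stdComplex_single, hM, cA, cB, cu, cv, o1, o2, o4, hp, ha]

/-- At a switch of type S3, the coefficient of the inner disk is multiplied by `r` and that of the
outer disk by `-r⁻¹`. The handleslide between the companions cancels the component `a A • e_u` of
the new differential of `e_B`. -/
theorem switch_nestedBelow_commute (hAB : A < B) (hσ : ∀ p, σ (σ p) = p)
    (hu : σ A = u) (hv : σ B = v)
    (h1 : B < v) (h2 : v < u) (hr : r ≠ 0)
    (hMA : M (Pi.single A 1) = -r • Pi.single A 1)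
    (hMB : M (Pi.single B 1) = Pi.single A 1 + r⁻¹ • Pi.single B 1)
    (hMc : M (Pi.single v 1) = Pi.single v 1 - ((a A : F) * r⁻¹ * (a B : F)⁻¹) • Pi.single u 1)
    (hM : ∀ p, p ≠ A → p ≠ B → p ≠ v → M (Pi.single p 1) = Pi.single p 1)
    (h_aA : (a' A : F) = -r⁻¹ * a A) (h_aB : (a' B : F) = r * a B)
    (ha : ∀ p, p ≠ A → p ≠ B → p ≠ u → p ≠ v → a' p = a p) (p : Fin s) :
    M ((stdComplex σ hσ a).d (Pi.single p 1)) =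
      (stdComplex σ hσ a').d (M (Pi.single p 1)) := by
  have hu' : σ u = A := by rw [← hu, hσ]
  have hv' : σ v = B := by rw [← hv, hσ]
  have lAu : A < u := by order
  have lBu : B < u := by order
  by_cases cA : p = A
  · subst cA
    simp [stdComplex_single, hu, hMA, hM, lAu, lAu.ne', lBu.ne', h2.ne', h_aA]
    match_scalars
    field_simp
  by_cases cB : p = B
  · subst cB
    simp [stdComplex_single, hu, hv, hMB, hMc, lAu, h1, h_aA, h_aB]
    match_scalars <;> field_simp
  by_cases cu : p = u
  · subst cu
    simp [stdComplex_single, hu', hM, lAu.ne', lAu.not_gt, lBu.ne', h2.ne']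
  by_cases cv : p = v
  · subst cv
    simp [stdComplex_single, hu', hv', hMc, lAu.not_gt, h1.not_gt]
  have o1 : σ p ≠ A := fun e => cu (by rw [← hu, ← e, hσ])
  have o2 : σ p ≠ B := fun e => cv (by rw [← hv, ← e, hσ])
  have o4 : σ p ≠ v := fun e => cB (by rw [← hv', ← e, hσ])
  by_cases hp : p < σ p <;> simp [stdComplex_single, hM, cA, cB, cu, cv, o1, o2, o4, hp, ha]

/-- At a return of type R1, the coefficients of the disks do not change, and no handleslide is
needed after the crossing. -/
theorem return_disjoint_commute (hAB : A < B) (hσ : ∀ p, σ (σ p) = p)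
    (hτ : ∀ p, τ (τ p) = p) (hu : σ A = u) (hv : σ B = v)
    (hA : τ A = v) (hB : τ B = u) (hτo : ∀ p, p ≠ A → p ≠ B → p ≠ u → p ≠ v → τ p = σ p)
    (h1 : v < A) (h2 : B < u)
    (hMA : M (Pi.single A 1) = Pi.single B 1 - r • Pi.single A 1)
    (hMB : M (Pi.single B 1) = Pi.single A 1)
    (hM : ∀ p, p ≠ A → p ≠ B → M (Pi.single p 1) = Pi.single p 1)
    (h_aB : a' B = a A) (h_av : a' v = a v)
    (ha : ∀ p, p ≠ A → p ≠ B → p ≠ u → p ≠ v → a' p = a p) (p : Fin s) :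
    M ((stdComplex σ hσ a).d (Pi.single p 1)) =
      (stdComplex τ hτ a').d (M (Pi.single p 1)) := by
  have hu' : σ u = A := by rw [← hu, hσ]
  have hv' : σ v = B := by rw [← hv, hσ]
  have hA' : τ v = A := by rw [← hA, hτ]
  have hB' : τ u = B := by rw [← hB, hτ]
  have lAu : A < u := by order
  have lvB : v < B := by order
  by_cases cA : p = A
  · subst cA
    simp [stdComplex_single, hu, hA, hB, hMA, hM, lAu, lAu.ne', h2, h2.ne', h1.not_gt, h_aB]
  by_cases cB : p = B
  · subst cB
    simp [stdComplex_single, hv, hA, hMB, h1.not_gt, lvB.not_gt]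
  by_cases cu : p = u
  · subst cu
    simp [stdComplex_single, hu', hB', hM, lAu.ne', lAu.not_gt, h2.ne', h2.not_gt]
  by_cases cv : p = v
  · subst cv
    simp [stdComplex_single, hv', hA', hMB, hM, h1, h1.ne, lvB, lvB.ne, h_av]
  have o1 : σ p ≠ A := fun e => cu (by rw [← hu, ← e, hσ])
  have o2 : σ p ≠ B := fun e => cv (by rw [← hv, ← e, hσ])
  by_cases hp : p < σ p <;> simp [stdComplex_single, hM, cA, cB, cu, cv, o1, o2, hp, ha, hτo]

/-- At a return of type R2, the coefficients of the disks do not change. The handleslide between the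
companions cancels the component `-(a u * r) • e_A` of the new differential of `e_u`. -/
theorem return_nestedAbove_commute (hAB : A < B) (hσ : ∀ p, σ (σ p) = p)
    (hτ : ∀ p, τ (τ p) = p) (hu : σ A = u) (hv : σ B = v)
    (hA : τ A = v) (hB : τ B = u) (hτo : ∀ p, p ≠ A → p ≠ B → p ≠ u → p ≠ v → τ p = σ p)
    (h1 : u < v) (h2 : v < A)
    (hMA : M (Pi.single A 1) = Pi.single B 1 - r • Pi.single A 1)
    (hMB : M (Pi.single B 1) = Pi.single A 1)
    (hMc : M (Pi.single u 1) = Pi.single u 1 - ((a u : F) * r * (a v : F)⁻¹) • Pi.single v 1)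
    (hM : ∀ p, p ≠ A → p ≠ B → p ≠ u → M (Pi.single p 1) = Pi.single p 1)
    (h_au : a' u = a u) (h_av : a' v = a v)
    (ha : ∀ p, p ≠ A → p ≠ B → p ≠ u → p ≠ v → a' p = a p) (p : Fin s) :
    M ((stdComplex σ hσ a).d (Pi.single p 1)) =
      (stdComplex τ hτ a').d (M (Pi.single p 1)) := by
  have hu' : σ u = A := by rw [← hu, hσ]
  have hv' : σ v = B := by rw [← hv, hσ]
  have hA' : τ v = A := by rw [← hA, hτ]
  have hB' : τ u = B := by rw [← hB, hτ]
  have luA : u < A := by order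
  have luB : u < B := by order
  have lvB : v < B := by order
  by_cases cA : p = A
  · subst cA
    simp [stdComplex_single, hu, hA, hB, hMA, luA.not_gt, luB.not_gt, h2.not_gt]
  by_cases cB : p = B
  · subst cB
    simp [stdComplex_single, hv, hA, hMB, h2.not_gt, lvB.not_gt]
  by_cases cu : p = u
  · subst cu
    simp [stdComplex_single, hu', hA', hB', hMA, hMc, luA, luB, h2, h_au, h_av]
    match_scalars <;> field_simp
  by_cases cv : p = v
  · subst cv
    simp [stdComplex_single, hv', hA', hMB, hM, h1.ne', h2, h2.ne, lvB, lvB.ne, h_av]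
  have o1 : σ p ≠ A := fun e => cu (by rw [← hu, ← e, hσ])
  have o2 : σ p ≠ B := fun e => cv (by rw [← hv, ← e, hσ])
  have o3 : σ p ≠ u := fun e => cA (by rw [← hu', ← e, hσ])
  by_cases hp : p < σ p <;> simp [stdComplex_single, hM, cA, cB, cu, cv, o1, o2, o3, hp, ha, hτo]

/-- At a return of type R3, the coefficients of the disks do not change. The handleslide between the
companions cancels the component `(r * a B) • e_v` of the new differential of `e_B`. -/
theorem return_nestedBelow_commute (hAB : A < B) (hσ : ∀ p, σ (σ p) = p)
    (hτ : ∀ p, τ (τ p) = p) (hu : σ A = u) (hv : σ B = v)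
    (hA : τ A = v) (hB : τ B = u) (hτo : ∀ p, p ≠ A → p ≠ B → p ≠ u → p ≠ v → τ p = σ p)
    (h1 : B < u) (h2 : u < v)
    (hMA : M (Pi.single A 1) = Pi.single B 1 - r • Pi.single A 1)
    (hMB : M (Pi.single B 1) = Pi.single A 1)
    (hMc : M (Pi.single u 1) = Pi.single u 1 - ((a A : F)⁻¹ * r * (a B : F)) • Pi.single v 1)
    (hM : ∀ p, p ≠ A → p ≠ B → p ≠ u → M (Pi.single p 1) = Pi.single p 1)
    (h_aA : a' A = a B) (h_aB : a' B = a A)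
    (ha : ∀ p, p ≠ A → p ≠ B → p ≠ u → p ≠ v → a' p = a p) (p : Fin s) :
    M ((stdComplex σ hσ a).d (Pi.single p 1)) =
      (stdComplex τ hτ a').d (M (Pi.single p 1)) := by
  have hu' : σ u = A := by rw [← hu, hσ]
  have hv' : σ v = B := by rw [← hv, hσ]
  have hA' : τ v = A := by rw [← hA, hτ]
  have hB' : τ u = B := by rw [← hB, hτ]
  have lAu : A < u := by order
  have lAv : A < v := by order
  have lBv : B < v := by order
  by_cases cA : p = A
  · subst cA
    simp [stdComplex_single, hu, hA, hB, hMA, hMc, lAu, lAv, h1, h_aA, h_aB]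
    match_scalars <;> field_simp
  by_cases cB : p = B
  · subst cB
    simp [stdComplex_single, hv, hA, hMB, hM, lAv, lAv.ne', lBv, lBv.ne', h2.ne', h_aA]
  by_cases cu : p = u
  · subst cu
    simp [stdComplex_single, hu', hA', hB', hMc, lAu.not_gt, lAv.not_gt, h1.not_gt]
  by_cases cv : p = v
  · subst cv
    simp [stdComplex_single, hv', hA', hM, lAv.ne', lAv.not_gt, lBv.ne', lBv.not_gt, h2.ne']
  have o1 : σ p ≠ A := fun e => cu (by rw [← hu, ← e, hσ])
  have o2 : σ p ≠ B := fun e => cv (by rw [← hv, ← e, hσ])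
  have o3 : σ p ≠ u := fun e => cA (by rw [← hu', ← e, hσ])
  by_cases hp : p < σ p <;> simp [stdComplex_single, hM, cA, cB, cu, cv, o1, o2, o3, hp, ha, hτo]

end Crossing

/-! ### Crossings and cusps of a normal ruling -/

section Patterns

variable {σ : Equiv.Perm (Fin s)} {A B : Fin s}

theorem NestedAbove.not_disjointDisks (h : NestedAbove σ A B) (hAB : A < B) :
    ¬ DisjointDisks σ A B := fun h' => by
  unfold NestedAbove at h; unfold DisjointDisks at h'; order

theorem NestedBelow.not_disjointDisks (h : NestedBelow σ A B) (hAB : A < B) :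
    ¬ DisjointDisks σ A B := fun h' => by
  unfold NestedBelow at h; unfold DisjointDisks at h'; order

theorem NestedBelow.not_nestedAbove (h : NestedBelow σ A B) (hAB : A < B) :
    ¬ NestedAbove σ A B := fun h' => by
  unfold NestedBelow at h; unfold NestedAbove at h'; order

end Patterns

/-- A crossing at which the paths of the disks cross is not a switch. -/
theorem ne_of_eq_cross_mul {k : ℕ} {hk : k + 1 < s} {σ τ : Equiv.Perm (Fin s)}
    (hfix : ∀ p, σ p ≠ p) (hne : σ ⟨k, by omega⟩ ≠ ⟨k + 1, hk⟩)
    (h : τ = cross k hk * σ * cross k hk) : σ ≠ τ := by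
  intro e
  rw [← e] at h
  have := Equiv.congr_fun h ⟨k, by omega⟩
  simp only [Equiv.Perm.mul_apply, cross, Equiv.swap_apply_left] at this
  rw [Equiv.swap_apply_def] at this
  split_ifs at this with h1 h2
  · exact hne this
  · exact hfix _ this
  · exact absurd (σ.injective this) (by simp)

namespace Piece

theorem not_isSwitch_of_isReturn {pc : Piece s t} {σ : Equiv.Perm (Fin s)}
    {τ : Equiv.Perm (Fin t)} (hfix : ∀ p, σ p ≠ p) (hstep : pc.RulingStep σ τ)
    (h : pc.IsReturn σ τ) : ¬ pc.IsSwitch σ τ := by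
  cases pc with
  | leftCusp => exact h.elim
  | rightCusp => exact h.elim
  | crossing k hk => exact fun h' => ne_of_eq_cross_mul hfix hstep.1 h.1 h'.1

theorem rulingJoins_left_unique {pc : Piece s t} {σ : Equiv.Perm (Fin s)} {τ : Equiv.Perm (Fin t)}
    {p p' : Fin s} {q : Fin t} (h : pc.RulingJoins σ τ p q) (h' : pc.RulingJoins σ τ p' q) :
    p = p' := by
  cases pc with
  | leftCusp k hk => exact skip_injective k (h.symm.trans h')
  | rightCusp k hk => exact h.trans h'.symm
  | crossing k hk =>
    simp only [RulingJoins] at h h'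
    split_ifs at h h' with hs
    · exact h.symm.trans h'
    · exact (cross k hk).injective (h.symm.trans h')

theorem rulingJoins_right_unique {pc : Piece s t} {σ : Equiv.Perm (Fin s)}
    {τ : Equiv.Perm (Fin t)} {p : Fin s} {q q' : Fin t} (h : pc.RulingJoins σ τ p q)
    (h' : pc.RulingJoins σ τ p q') : q = q' := by
  cases pc with
  | leftCusp k hk => exact h.trans h'.symm
  | rightCusp k hk => exact skip_injective k (h.symm.trans h')
  | crossing k hk => exact h.trans h'.symm

/-- The boundary paths of the disks respect the pairings. -/
theorem RulingJoins.companion {pc : Piece s t} {σ : Equiv.Perm (Fin s)} {τ : Equiv.Perm (Fin t)}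
    (hstep : pc.RulingStep σ τ) {p : Fin s} {q : Fin t}
    (h : pc.RulingJoins σ τ p q) : pc.RulingJoins σ τ (σ p) (τ q) := by
  cases pc with
  | leftCusp k hk =>
    simp only [RulingJoins] at h ⊢
    rw [h, hstep.2]
  | rightCusp k hk =>
    simp only [RulingJoins] at h ⊢
    rw [h, hstep.2]
  | crossing k hk =>
    simp only [RulingJoins] at h ⊢
    split_ifs at h ⊢ with hs
    · rw [h, hs.1]
    · rcases hstep.2 with h2 | h2
      · rw [h, h2]
        simp [cross]
      · exact absurd h2 hs

/-- Two strands which do not continue to the left of the piece are equal or paired. -/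
theorem eq_or_eq_companion_of_no_left {pc : Piece s t} {σ : Equiv.Perm (Fin s)}
    {τ : Equiv.Perm (Fin t)} (hτ : ∀ p, τ (τ p) = p) (hstep : pc.RulingStep σ τ) {q q' : Fin t}
    (h : ¬ ∃ p, pc.RulingJoins σ τ p q) (h' : ¬ ∃ p, pc.RulingJoins σ τ p q') :
    q' = q ∨ q' = τ q := by
  cases pc with
  | rightCusp k hk => exact absurd ⟨_, rfl⟩ h
  | crossing k hk =>
    refine absurd ?_ h
    simp only [RulingJoins]
    split_ifs
    · exact ⟨_, rfl⟩
    · exact ⟨cross k hk q, by simp [cross]⟩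
  | leftCusp k hk =>
    have key : ∀ x : Fin (s + 2), (¬ ∃ p, x = skip k p) →
        x = ⟨k, by omega⟩ ∨ x = ⟨k + 1, by omega⟩ := by
      intro x hx
      by_contra! hc
      exact hx (exists_skip_eq (fun e => hc.1 (Fin.ext e)) (fun e => hc.2 (Fin.ext e)) hk)
    have h1 := hstep.1
    have h2 : τ (⟨k + 1, by omega⟩ : Fin (s + 2)) = ⟨k, by omega⟩ := by rw [← h1, hτ]
    rcases key q h with e | e <;> rcases key q' h' with e' | e' <;> rw [e, e'] <;> simp [h1, h2]

/-- A strand either continues to the right of the piece or ends at a right cusp. -/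
theorem exists_rulingJoins_or_rightCusp (pc : Piece s t) (σ : Equiv.Perm (Fin s))
    (τ : Equiv.Perm (Fin t)) (p : Fin s) :
    (∃ q, pc.RulingJoins σ τ p q) ∨ ∃ u l, pc.IsRightCuspAt u l ∧ (p = u ∨ p = l) := by
  cases pc with
  | leftCusp k hk => exact .inl ⟨_, rfl⟩
  | crossing k hk => exact .inl ⟨_, rfl⟩
  | rightCusp k hk =>
    by_cases h1 : (p : ℕ) = k
    · exact .inr ⟨⟨k, by omega⟩, ⟨k + 1, by omega⟩, ⟨rfl, rfl⟩, .inl (Fin.ext h1)⟩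
    by_cases h2 : (p : ℕ) = k + 1
    · exact .inr ⟨⟨k, by omega⟩, ⟨k + 1, by omega⟩, ⟨rfl, rfl⟩, .inr (Fin.ext h2)⟩
    exact .inl (exists_skip_eq h1 h2 hk)

theorem IsRightCuspAt.companion {pc : Piece s t} {σ : Equiv.Perm (Fin s)} {τ : Equiv.Perm (Fin t)}
    (hstep : pc.RulingStep σ τ) {u l : Fin s} (h : pc.IsRightCuspAt u l) : σ u = l := by
  cases pc with
  | leftCusp k hk => exact h.elim
  | crossing k hk => exact h.elim
  | rightCusp k hk =>
    rw [show u = ⟨k, by omega⟩ from Fin.ext h.1, show l = ⟨k + 1, by omega⟩ from Fin.ext h.2]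
    exact hstep.1

theorem IsRightCuspAt.no_right {pc : Piece s t} {σ : Equiv.Perm (Fin s)} {τ : Equiv.Perm (Fin t)}
    {u l : Fin s} (h : pc.IsRightCuspAt u l) (q : Fin t) : ¬ pc.RulingJoins σ τ u q := by
  cases pc with
  | leftCusp k hk => exact h.elim
  | crossing k hk => exact h.elim
  | rightCusp k hk =>
    intro hj
    exact (skip_val_ne k q).1 ((congrArg Fin.val hj).symm.trans h.1)

theorem IsLeftCuspAt.no_left {pc : Piece s t} {σ : Equiv.Perm (Fin s)} {τ : Equiv.Perm (Fin t)}
    {u l : Fin t} (h : pc.IsLeftCuspAt u l) (p : Fin s) : ¬ pc.RulingJoins σ τ p u := by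
  cases pc with
  | rightCusp k hk => exact h.elim
  | crossing k hk => exact h.elim
  | leftCusp k hk =>
    intro hj
    exact (skip_val_ne k p).1 ((congrArg Fin.val hj).symm.trans h.1)

theorem IsRightCuspAt.not_isSwitch {pc : Piece s t} {σ : Equiv.Perm (Fin s)}
    {τ : Equiv.Perm (Fin t)} {u l : Fin s} (h : pc.IsRightCuspAt u l) : ¬ pc.IsSwitch σ τ := by
  cases pc with
  | leftCusp k hk => exact h.elim
  | crossing k hk => exact h.elim
  | rightCusp k hk => exact id

theorem IsRightCuspAt.unique {pc : Piece s t} {u l u' l' : Fin s} (h : pc.IsRightCuspAt u l)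
    (h' : pc.IsRightCuspAt u' l') : u = u' ∧ l = l' := by
  cases pc with
  | leftCusp k hk => exact h.elim
  | crossing k hk => exact h.elim
  | rightCusp k hk => exact ⟨Fin.ext (h.1.trans h'.1.symm), Fin.ext (h.2.trans h'.2.symm)⟩

theorem IsCrossingAt.unique {pc : Piece s t} {u l u' l' : Fin s} (h : pc.IsCrossingAt u l)
    (h' : pc.IsCrossingAt u' l') : u = u' ∧ l = l' := by
  cases pc with
  | leftCusp k hk => exact h.elim
  | rightCusp k hk => exact h.elim
  | crossing k hk => exact ⟨Fin.ext (h.1.trans h'.1.symm), Fin.ext (h.2.trans h'.2.symm)⟩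

theorem IsRightCuspAt.not_isReturn {pc : Piece s t} {σ : Equiv.Perm (Fin s)}
    {τ : Equiv.Perm (Fin t)} {u l : Fin s} (h : pc.IsRightCuspAt u l) : ¬ pc.IsReturn σ τ := by
  cases pc with
  | leftCusp k hk => exact h.elim
  | crossing k hk => exact h.elim
  | rightCusp k hk => exact id

theorem IsRightCuspAt.not_isCrossingAt {pc : Piece s t} {u l u' l' : Fin s}
    (h : pc.IsRightCuspAt u l) : ¬ pc.IsCrossingAt u' l' := by
  cases pc with
  | leftCusp k hk => exact h.elim
  | crossing k hk => exact h.elim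
  | rightCusp k hk => exact id

theorem IsRightCuspAt.lt {pc : Piece s t} {u l : Fin s} (h : pc.IsRightCuspAt u l) : u < l := by
  cases pc with
  | leftCusp k hk => exact h.elim
  | crossing k hk => exact h.elim
  | rightCusp k hk => rw [Fin.lt_def, h.1, h.2]; omega

theorem diskFactor_eq_one {pc : Piece s t} {σ : Equiv.Perm (Fin s)} {P : Fin s → Prop}
    (hP : ∀ p, ¬ P p) (x : Fˣ) : pc.diskFactor σ P x = 1 := by
  cases pc with
  | leftCusp k hk => rfl
  | rightCusp k hk => rfl
  | crossing k hk => simp [diskFactor, hP]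

/-! ### Handleslide marks of an SR-form -/

theorem lt_of_mem_leftMarks {R : Type*} {pc : Piece s t} {r : R} {h : Handleslide R s}
    (hh : h ∈ pc.leftMarks r) : h.upper < h.lower := by
  cases pc with
  | leftCusp k hk => simp [leftMarks] at hh
  | rightCusp k hk =>
    rw [leftMarks, List.mem_singleton] at hh
    rw [hh, Fin.lt_def]; exact Nat.lt_succ_self k
  | crossing k hk =>
    rw [leftMarks, List.mem_singleton] at hh
    rw [hh, Fin.lt_def]; exact Nat.lt_succ_self k

theorem leftMarks_injective {R : Type*} {pc : Piece s t} (hpc : ¬ ∃ u l, pc.IsLeftCuspAt u l)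
    {r r' : R} (h : pc.leftMarks r = pc.leftMarks r') : r = r' := by
  cases pc with
  | leftCusp k hk => exact absurd ⟨⟨k, by omega⟩, ⟨k + 1, by omega⟩, rfl, rfl⟩ hpc
  | rightCusp k hk => simpa [leftMarks] using h
  | crossing k hk => simpa [leftMarks] using h

theorem length_leftMarks {R : Type*} {pc : Piece s t} (hpc : ¬ ∃ u l, pc.IsLeftCuspAt u l)
    (r : R) : (pc.leftMarks r).length = 1 := by
  cases pc with
  | leftCusp k hk => exact absurd ⟨⟨k, by omega⟩, ⟨k + 1, by omega⟩, rfl, rfl⟩ hpc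
  | rightCusp k hk => rfl
  | crossing k hk => rfl

/-- The piece contains a crossing which is a switch or return, or a right cusp. -/
def CarriesMarks (pc : Piece s t) (σ : Equiv.Perm (Fin s)) (τ : Equiv.Perm (Fin t)) : Prop :=
  pc.IsSwitch σ τ ∨ pc.IsReturn σ τ ∨ ∃ u l, pc.IsRightCuspAt u l

theorem CarriesMarks.not_leftCusp {pc : Piece s t} {σ : Equiv.Perm (Fin s)}
    {τ : Equiv.Perm (Fin t)} (h : pc.CarriesMarks σ τ) : ¬ ∃ u l, pc.IsLeftCuspAt u l := by
  cases pc with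
  | leftCusp k hk => simp [CarriesMarks, IsSwitch, IsReturn, IsRightCuspAt] at h
  | rightCusp k hk => simp [IsLeftCuspAt]
  | crossing k hk => simp [IsLeftCuspAt]

section RightMarks

variable {k : ℕ} {hk : k + 1 < s} {σ τ : Equiv.Perm (Fin s)} {A B : Fin s} {C : TriComplex F s}
  {r : F}

theorem rightMarks_switch_disjoint (hA : A = ⟨k, by omega⟩) (hB : B = ⟨k + 1, hk⟩)
    (h : DisjointDisks σ A B) :
    (crossing k hk).rightMarks σ σ C r = [⟨A, B, -r⁻¹⟩] := by
  subst hA hB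
  simp [rightMarks, h]

theorem rightMarks_switch_nestedAbove (hA : A = ⟨k, by omega⟩) (hB : B = ⟨k + 1, hk⟩)
    (h : NestedAbove σ A B) :
    (crossing k hk).rightMarks σ σ C r = [⟨A, B, -r⁻¹⟩,
      ⟨σ B, σ A, C.coeff (σ B) B * r⁻¹ * (C.coeff (σ A) A)⁻¹⟩] := by
  have hd := h.not_disjointDisks (by rw [hA, hB, Fin.lt_def]; exact Nat.lt_succ_self k)
  subst hA hB
  simp [rightMarks, h, hd]

theorem rightMarks_switch_nestedBelow (hA : A = ⟨k, by omega⟩) (hB : B = ⟨k + 1, hk⟩)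
    (h : NestedBelow σ A B) :
    (crossing k hk).rightMarks σ σ C r = [⟨A, B, -r⁻¹⟩,
      ⟨σ B, σ A, C.coeff A (σ A) * r⁻¹ * (C.coeff B (σ B))⁻¹⟩] := by
  have hd := h.not_disjointDisks (by rw [hA, hB, Fin.lt_def]; exact Nat.lt_succ_self k)
  have hn := h.not_nestedAbove (by rw [hA, hB, Fin.lt_def]; exact Nat.lt_succ_self k)
  subst hA hB
  simp [rightMarks, hd, hn]

theorem rightMarks_return_disjoint (hA : A = ⟨k, by omega⟩) (hB : B = ⟨k + 1, hk⟩) (hne : σ ≠ τ)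
    (h : DisjointDisks τ A B) : (crossing k hk).rightMarks σ τ C r = [] := by
  subst hA hB
  simp [rightMarks, h, hne]

theorem rightMarks_return_nestedAbove (hA : A = ⟨k, by omega⟩) (hB : B = ⟨k + 1, hk⟩)
    (hne : σ ≠ τ) (h : NestedAbove τ A B) :
    (crossing k hk).rightMarks σ τ C r =
      [⟨τ B, τ A, C.coeff (σ A) A * r * (C.coeff (σ B) B)⁻¹⟩] := by
  have hd := h.not_disjointDisks (by rw [hA, hB, Fin.lt_def]; exact Nat.lt_succ_self k)
  subst hA hB
  simp [rightMarks, h, hd, hne]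

theorem rightMarks_return_nestedBelow (hA : A = ⟨k, by omega⟩) (hB : B = ⟨k + 1, hk⟩)
    (hne : σ ≠ τ) (h : NestedBelow τ A B) :
    (crossing k hk).rightMarks σ τ C r =
      [⟨τ B, τ A, (C.coeff A (σ A))⁻¹ * r * C.coeff B (σ B)⟩] := by
  have hd := h.not_disjointDisks (by rw [hA, hB, Fin.lt_def]; exact Nat.lt_succ_self k)
  have hn := h.not_nestedAbove (by rw [hA, hB, Fin.lt_def]; exact Nat.lt_succ_self k)
  subst hA hB
  simp [rightMarks, hd, hn, hne]

end RightMarks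

/-- The endpoints of a mark on the right of a switch or return are the crossing strands, in this
order, or their companions, in an order which is the opposite of that of the crossing strands. -/
theorem mem_rightMarks {k : ℕ} {hk : k + 1 < s} {σ τ : Equiv.Perm (Fin s)} {A B : Fin s}
    {C : TriComplex F s} {r : F} (hA : A = ⟨k, by omega⟩) (hB : B = ⟨k + 1, hk⟩)
    (hfix : ∀ p, σ p ≠ p) (hstep : (crossing k hk).RulingStep σ τ)
    (hm : (crossing k hk).CarriesMarks σ τ) {h : Handleslide F s}
    (hh : h ∈ (crossing k hk).rightMarks σ τ C r) :
    (h.upper = A ∧ h.lower = B) ∨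
      (h.upper = τ B ∧ h.lower = τ A ∧ (NestedAbove τ A B ∨ NestedBelow τ A B)) := by
  rcases hm with hm | hm | ⟨u, l, hm⟩
  · obtain rfl : σ = τ := hm.1
    have hn := hm.2
    rw [← hA, ← hB] at hn
    rcases hn with hn | hn | hn
    · rw [rightMarks_switch_disjoint hA hB hn, List.mem_singleton] at hh
      subst hh; exact .inl ⟨rfl, rfl⟩
    · rw [rightMarks_switch_nestedAbove hA hB hn, List.mem_pair] at hh
      rcases hh with rfl | rfl
      · exact .inl ⟨rfl, rfl⟩
      · exact .inr ⟨rfl, rfl, .inl hn⟩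
    · rw [rightMarks_switch_nestedBelow hA hB hn, List.mem_pair] at hh
      rcases hh with rfl | rfl
      · exact .inl ⟨rfl, rfl⟩
      · exact .inr ⟨rfl, rfl, .inr hn⟩
  · have hne := ne_of_eq_cross_mul hfix hstep.1 hm.1
    have hn := hm.2
    rw [← hA, ← hB] at hn
    rcases hn with hn | hn | hn
    · rw [rightMarks_return_disjoint hA hB hne hn] at hh
      simp at hh
    · rw [rightMarks_return_nestedAbove hA hB hne hn, List.mem_singleton] at hh
      subst hh; exact .inr ⟨rfl, rfl, .inl hn⟩
    · rw [rightMarks_return_nestedBelow hA hB hne hn, List.mem_singleton] at hh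
      subst hh; exact .inr ⟨rfl, rfl, .inr hn⟩
  · exact hm.elim

theorem lt_of_mem_rightMarks {pc : Piece s t} {σ : Equiv.Perm (Fin s)} {τ : Equiv.Perm (Fin t)}
    {C : TriComplex F s} {r : F} (hfix : ∀ p, σ p ≠ p) (hstep : pc.RulingStep σ τ)
    (hm : pc.CarriesMarks σ τ) {h : Handleslide F t} (hh : h ∈ pc.rightMarks σ τ C r) :
    h.upper < h.lower := by
  cases pc with
  | leftCusp k hk => simp [rightMarks] at hh
  | rightCusp k hk => simp [rightMarks] at hh
  | crossing k hk =>
    rcases mem_rightMarks rfl rfl hfix hstep hm hh with ⟨h1, h2⟩ | ⟨h1, h2, h3 | h3⟩ <;> rw [h1, h2]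
    · rw [Fin.lt_def]; exact Nat.lt_succ_self k
    · exact h3.1
    · exact h3.2

/-! ### The standard complexes on the two sides of a piece -/

/-- The relation between the disk coefficients `a`, `a'` on the two sides of a piece: they change by
the factors of the disk equations, and a new disk has coefficient `1`. -/
def CoeffStep (pc : Piece s t) (σ : Equiv.Perm (Fin s)) (τ : Equiv.Perm (Fin t)) (x : Fˣ)
    (a : Fin s → Fˣ) (a' : Fin t → Fˣ) : Prop :=
  (∀ p q, pc.RulingJoins σ τ p q → a' q =
    a p * if pc.IsSwitch σ τ then pc.diskFactor σ (fun p' => p' = p ∨ p' = σ p) x else 1) ∧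
    ∀ u l, pc.IsLeftCuspAt u l → a' u = 1

theorem bijective_onBasis_perm (e : Equiv.Perm (Fin s)) :
    Function.Bijective (onBasis fun i => (Pi.single (e i) 1 : Fin s → F)) := by
  refine Function.bijective_iff_has_inverse.2
    ⟨onBasis fun i => (Pi.single (e.symm i) 1 : Fin s → F), fun v => ?_, fun v => ?_⟩
  · refine LinearMap.congr_fun (f := (onBasis fun i => (Pi.single (e.symm i) 1 : Fin s → F)) ∘ₗ
      onBasis fun i => (Pi.single (e i) 1 : Fin s → F)) (g := LinearMap.id) ?_ v
    exact linearMap_ext_single fun i => by simp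
  · refine LinearMap.congr_fun (f := (onBasis fun i => (Pi.single (e i) 1 : Fin s → F)) ∘ₗ
      onBasis fun i => (Pi.single (e.symm i) 1 : Fin s → F)) (g := LinearMap.id) ?_ v
    exact linearMap_ext_single fun i => by simp

/-- At a switch, the marks around the crossing turn the standard complex before the crossing into
the standard complex after it. -/
theorem complexStep_switch {k : ℕ} {hk : k + 1 < s} {σ : Equiv.Perm (Fin s)}
    (hσ : ∀ p, σ (σ p) = p) (hfix : ∀ p, σ p ≠ p) {a a' : Fin s → Fˣ} {x : Fˣ} {r : F}
    (hs : (crossing k hk).IsSwitch σ σ) (hne : σ ⟨k, by omega⟩ ≠ ⟨k + 1, hk⟩)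
    (ha : ∀ p, a' p = a p * (crossing k hk).diskFactor σ (fun p' => p' = p ∨ p' = σ p) x)
    (hr : r = if (crossing k hk).IsNestedBelow σ then -(x : F) else x)
    (hlt : ∀ h ∈ (crossing k hk).rightMarks σ σ (stdComplex σ hσ a) r, h.upper < h.lower) :
    (crossing k hk).ComplexStep (slides ((crossing k hk).leftMarks r) (stdComplex σ hσ a))
      (unslides ((crossing k hk).rightMarks σ σ (stdComplex σ hσ a) r) (stdComplex σ hσ a')) := by
  refine isComplexIso_slides_unslides (fun h hh => lt_of_mem_leftMarks hh) hlt
    (bijective_onBasis_perm _) ?_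
  clear hlt
  have hn := hs.2
  simp only [diskFactor] at ha
  have hr1 : NestedBelow σ ⟨k, by omega⟩ ⟨k + 1, hk⟩ → r = -x := fun h => hr.trans (if_pos h)
  have hr2 : ¬ NestedBelow σ ⟨k, by omega⟩ ⟨k + 1, hk⟩ → r = x := fun h => hr.trans (if_neg h)
  simp only [leftMarks]
  obtain ⟨A, hA⟩ : ∃ A : Fin s, A = ⟨k, by omega⟩ := ⟨_, rfl⟩
  obtain ⟨B, hB⟩ : ∃ B : Fin s, B = ⟨k + 1, hk⟩ := ⟨_, rfl⟩
  have hAB : A < B := by rw [hA, hB, Fin.lt_def]; exact Nat.lt_succ_self k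
  have hc : cross k hk = Equiv.swap A B := by rw [hA, hB]; rfl
  rw [hc]
  rw [← hA, ← hB] at hn hne hr1 hr2
  simp only [← hA, ← hB] at ha ⊢
  obtain ⟨u, hu⟩ : ∃ u, σ A = u := ⟨_, rfl⟩
  obtain ⟨v, hv⟩ : ∃ v, σ B = v := ⟨_, rfl⟩
  have hu' : σ u = A := by rw [← hu, hσ]
  have hv' : σ v = B := by rw [← hv, hσ]
  have huA : u ≠ A := hu ▸ hfix A
  have hvB : v ≠ B := hv ▸ hfix B
  have huB : u ≠ B := hu ▸ hne
  have hvA : v ≠ A := fun e => hne (by rw [← e, hv'])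
  have hother : ∀ p, p ≠ A → p ≠ B → p ≠ u → p ≠ v → a' p = a p := by
    intro p h1 h2 h3 h4
    have h5 : A ≠ σ p := fun e => h3 (by rw [← hu, e, hσ])
    have h6 : B ≠ σ p := fun e => h4 (by rw [← hv, e, hσ])
    rw [ha]
    simp [h1.symm, h2.symm, h5, h6]
  rcases hn with hn | hn | hn
  · have hx : r = x := hr2 fun h => h.not_disjointDisks hAB hn
    have hr0 : r ≠ 0 := by rw [hx]; exact x.ne_zero
    rw [rightMarks_switch_disjoint hA hB hn]
    have h1 : u < A := hu ▸ hn.1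
    have h2 : B < v := hv ▸ hn.2
    intro p
    refine switch_disjoint_commute (M := slidesMap [⟨A, B, -r⁻¹⟩] ∘ₗ
      (onBasis fun i => (Pi.single (Equiv.swap A B i) 1 : Fin s → F)) ∘ₗ slidesMap [⟨A, B, r⟩])
      hAB hσ hu hv h1 h2 hr0 ?_ ?_ ?_ ?_ ?_ hother p
    · simp [slidesMap, hAB.ne', hr0]
    · simp [slidesMap, hAB.ne']
    · intro p h1 h2; simp [slidesMap, h1, h2, Equiv.swap_apply_of_ne_of_ne]
    · rw [ha, if_pos hn, if_pos (.inr hu'.symm), hx]; simp [mul_comm]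
    · rw [ha, if_pos hn, if_neg (by simp [hAB.ne, hv, hvA.symm]), if_pos (.inl rfl), hx]
      simp [mul_comm]
  · have hx : r = x := hr2 fun h => h.not_nestedAbove hAB hn
    have hr0 : r ≠ 0 := by rw [hx]; exact x.ne_zero
    have hd := hn.not_disjointDisks hAB
    rw [rightMarks_switch_nestedAbove hA hB hn]
    have h1 : v < u := by simpa [hu, hv] using hn.1
    have h2 : u < A := by simpa [hu] using hn.2
    rw [stdComplex_coeff' hσ a (by rw [hv]; order), stdComplex_coeff' hσ a (by rw [hu]; order),
      hu, hv]
    intro p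
    refine switch_nestedAbove_commute
      (M := slidesMap [⟨A, B, -r⁻¹⟩, ⟨v, u, a v * r⁻¹ * (a u : F)⁻¹⟩] ∘ₗ
      (onBasis fun i => (Pi.single (Equiv.swap A B i) 1 : Fin s → F)) ∘ₗ slidesMap [⟨A, B, r⟩])
      hAB hσ hu hv h1 h2 hr0 ?_ ?_ ?_ ?_ ?_ ?_ hother p
    · simp [slidesMap, hAB.ne', hr0, hvA.symm]
    · simp [slidesMap, hAB.ne', hvA.symm, hvB.symm]
    · simp [slidesMap, hvA, hvB, Equiv.swap_apply_of_ne_of_ne]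
    · intro p h1 h2 h3; simp [slidesMap, h1, h2, h3, Equiv.swap_apply_of_ne_of_ne]
    · rw [ha, if_neg hd, if_pos hn, if_pos (.inr hu'.symm), hx]; simp [mul_comm]
    · rw [ha, if_neg hd, if_pos hn, if_neg (by simp [hvA.symm, hv', hAB.ne]),
        if_pos (.inr hv'.symm), hx]
      simp [mul_comm]
  · have hx : r = -x := hr1 hn
    have hr0 : r ≠ 0 := by rw [hx]; exact neg_ne_zero.2 x.ne_zero
    have hd := hn.not_disjointDisks hAB
    have hna := hn.not_nestedAbove hAB
    rw [rightMarks_switch_nestedBelow hA hB hn]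
    have h1 : B < v := by simpa [hv] using hn.1
    have h2 : v < u := by simpa [hu, hv] using hn.2
    rw [stdComplex_coeff hσ a (by rw [hu]; order), stdComplex_coeff hσ a (by rw [hv]; order),
      hu, hv]
    intro p
    refine switch_nestedBelow_commute
      (M := slidesMap [⟨A, B, -r⁻¹⟩, ⟨v, u, a A * r⁻¹ * (a B : F)⁻¹⟩] ∘ₗ
      (onBasis fun i => (Pi.single (Equiv.swap A B i) 1 : Fin s → F)) ∘ₗ slidesMap [⟨A, B, r⟩])
      hAB hσ hu hv h1 h2 hr0 ?_ ?_ ?_ ?_ ?_ ?_ hother p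
    · simp [slidesMap, hAB.ne', hr0, hvA.symm]
    · simp [slidesMap, hAB.ne', hvA.symm, hvB.symm]
    · simp [slidesMap, hvA, hvB, Equiv.swap_apply_of_ne_of_ne]
    · intro p h1 h2 h3; simp [slidesMap, h1, h2, h3, Equiv.swap_apply_of_ne_of_ne]
    · rw [ha, if_neg hd, if_neg hna, if_neg (by simp [hAB.ne', hu, huB.symm]),
        if_pos (.inl rfl), hx]
      simp [mul_comm]
    · rw [ha, if_neg hd, if_neg hna, if_pos (.inl rfl), hx]; simp [mul_comm]

/-- At a crossing without marks which is not a switch, exchanging the crossing strands turns the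
standard complex before the crossing into the standard complex after it. -/
theorem complexStep_plain {k : ℕ} {hk : k + 1 < s} {σ τ : Equiv.Perm (Fin s)}
    (hσ : ∀ p, σ (σ p) = p) (hfix : ∀ p, σ p ≠ p) (hτ : ∀ p, τ (τ p) = p) {a a' : Fin s → Fˣ}
    (hστ : τ = cross k hk * σ * cross k hk) (hne : σ ⟨k, by omega⟩ ≠ ⟨k + 1, hk⟩)
    (ha : ∀ p, a' (cross k hk p) = a p) :
    (crossing k hk).ComplexStep (stdComplex σ hσ a) (stdComplex τ hτ a') := by
  refine ⟨bijective_onBasis_perm _, linearMap_ext_single fun p => ?_⟩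
  simp only [LinearMap.comp_apply, onBasis_single]
  refine plain_crossing_commute rfl hσ hfix hne hτ (fun p => ?_) ha p
  rw [hστ]
  simp [cross]

/-- At a return, the marks around the crossing turn the standard complex before the crossing into
the standard complex after it. -/
theorem complexStep_return {k : ℕ} {hk : k + 1 < s} {σ τ : Equiv.Perm (Fin s)}
    (hσ : ∀ p, σ (σ p) = p) (hfix : ∀ p, σ p ≠ p) (hτ : ∀ p, τ (τ p) = p) {a a' : Fin s → Fˣ}
    {r : F} (hs : (crossing k hk).IsReturn σ τ) (hne : σ ⟨k, by omega⟩ ≠ ⟨k + 1, hk⟩)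
    (ha : ∀ p, a' (cross k hk p) = a p)
    (hlt : ∀ h ∈ (crossing k hk).rightMarks σ τ (stdComplex σ hσ a) r, h.upper < h.lower) :
    (crossing k hk).ComplexStep (slides ((crossing k hk).leftMarks r) (stdComplex σ hσ a))
      (unslides ((crossing k hk).rightMarks σ τ (stdComplex σ hσ a) r) (stdComplex τ hτ a')) := by
  refine isComplexIso_slides_unslides (fun h hh => lt_of_mem_leftMarks hh) hlt
    (bijective_onBasis_perm _) ?_
  clear hlt
  have hστne := ne_of_eq_cross_mul hfix hne hs.1
  obtain ⟨hστ, hn⟩ := hs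
  simp only [leftMarks]
  obtain ⟨A, hA⟩ : ∃ A : Fin s, A = ⟨k, by omega⟩ := ⟨_, rfl⟩
  obtain ⟨B, hB⟩ : ∃ B : Fin s, B = ⟨k + 1, hk⟩ := ⟨_, rfl⟩
  have hAB : A < B := by rw [hA, hB, Fin.lt_def]; exact Nat.lt_succ_self k
  have hc : cross k hk = Equiv.swap A B := by rw [hA, hB]; rfl
  rw [hc] at hστ ha ⊢
  rw [← hA, ← hB] at hn hne
  simp only [← hA, ← hB]
  obtain ⟨u, hu⟩ : ∃ u, σ A = u := ⟨_, rfl⟩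
  obtain ⟨v, hv⟩ : ∃ v, σ B = v := ⟨_, rfl⟩
  have hu' : σ u = A := by rw [← hu, hσ]
  have hv' : σ v = B := by rw [← hv, hσ]
  have huA : u ≠ A := hu ▸ hfix A
  have hvB : v ≠ B := hv ▸ hfix B
  have huB : u ≠ B := hu ▸ hne
  have hvA : v ≠ A := fun e => hne (by rw [← e, hv'])
  have hτA : τ A = v := by
    simp [hστ, hv, Equiv.swap_apply_of_ne_of_ne hvA hvB]
  have hτB : τ B = u := by
    simp [hστ, hu, Equiv.swap_apply_of_ne_of_ne huA huB]
  have hτo : ∀ p, p ≠ A → p ≠ B → p ≠ u → p ≠ v → τ p = σ p := by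
    intro p h1 h2 h3 h4
    have h5 : σ p ≠ A := fun e => h3 (by rw [← hu, ← e, hσ])
    have h6 : σ p ≠ B := fun e => h4 (by rw [← hv, ← e, hσ])
    simp [hστ, Equiv.swap_apply_of_ne_of_ne h1 h2, Equiv.swap_apply_of_ne_of_ne h5 h6]
  have haA : a' A = a B := by simpa using ha B
  have haB : a' B = a A := by simpa using ha A
  have hao : ∀ p, p ≠ A → p ≠ B → a' p = a p := by
    intro p h1 h2
    simpa [Equiv.swap_apply_of_ne_of_ne h1 h2] using ha p
  rcases hn with hn | hn | hn
  · rw [rightMarks_return_disjoint hA hB hστne hn]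
    have h1 : v < A := by simpa [hτA] using hn.1
    have h2 : B < u := by simpa [hτB] using hn.2
    intro p
    refine return_disjoint_commute (r := r) (M := slidesMap [] ∘ₗ
      (onBasis fun i => (Pi.single (Equiv.swap A B i) 1 : Fin s → F)) ∘ₗ slidesMap [⟨A, B, r⟩])
      hAB hσ hτ hu hv hτA hτB hτo h1 h2 ?_ ?_ ?_ haB (hao v hvA hvB)
      (fun p h1 h2 _ _ => hao p h1 h2) p
    · simp [slidesMap]
    · simp [slidesMap, hAB.ne']
    · intro p h1 h2; simp [slidesMap, h1, h2, Equiv.swap_apply_of_ne_of_ne]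
  · rw [rightMarks_return_nestedAbove hA hB hστne hn, hτA, hτB]
    have h1 : u < v := by simpa [hτA, hτB] using hn.1
    have h2 : v < A := by simpa [hτA] using hn.2
    rw [stdComplex_coeff' hσ a (by rw [hu]; order), stdComplex_coeff' hσ a (by rw [hv]; order),
      hu, hv]
    intro p
    refine return_nestedAbove_commute (r := r)
      (M := slidesMap [⟨u, v, a u * r * (a v : F)⁻¹⟩] ∘ₗ
      (onBasis fun i => (Pi.single (Equiv.swap A B i) 1 : Fin s → F)) ∘ₗ slidesMap [⟨A, B, r⟩])
      hAB hσ hτ hu hv hτA hτB hτo h1 h2 ?_ ?_ ?_ ?_ (hao u huA huB) (hao v hvA hvB)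
      (fun p h1 h2 _ _ => hao p h1 h2) p
    · simp [slidesMap, huA.symm, huB.symm]
    · simp [slidesMap, hAB.ne', huA.symm]
    · simp [slidesMap, huA, huB, Equiv.swap_apply_of_ne_of_ne]
    · intro p h1 h2 h3; simp [slidesMap, h1, h2, h3, Equiv.swap_apply_of_ne_of_ne]
  · rw [rightMarks_return_nestedBelow hA hB hστne hn, hτA, hτB]
    have h1 : B < u := by simpa [hτB] using hn.1
    have h2 : u < v := by simpa [hτA, hτB] using hn.2
    rw [stdComplex_coeff hσ a (by rw [hu]; order), stdComplex_coeff hσ a (by rw [hv]; order)]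
    intro p
    refine return_nestedBelow_commute (r := r)
      (M := slidesMap [⟨u, v, (a A : F)⁻¹ * r * (a B : F)⟩] ∘ₗ
      (onBasis fun i => (Pi.single (Equiv.swap A B i) 1 : Fin s → F)) ∘ₗ slidesMap [⟨A, B, r⟩])
      hAB hσ hτ hu hv hτA hτB hτo h1 h2 ?_ ?_ ?_ ?_ haA haB
      (fun p h1 h2 _ _ => hao p h1 h2) p
    · simp [slidesMap, huA.symm, huB.symm]
    · simp [slidesMap, hAB.ne', huA.symm]
    · simp [slidesMap, huA, huB, Equiv.swap_apply_of_ne_of_ne]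
    · intro p h1 h2 h3; simp [slidesMap, h1, h2, h3, Equiv.swap_apply_of_ne_of_ne]

theorem isCuspQuotient_stdComplex {k : ℕ} (hk : k ≤ s) {σ : Equiv.Perm (Fin s)}
    {τ : Equiv.Perm (Fin (s + 2))} (hσ : ∀ p, σ (σ p) = p) (hτ : ∀ p, τ (τ p) = p)
    {a : Fin s → Fˣ} {a' : Fin (s + 2) → Fˣ} (hk' : τ ⟨k, by omega⟩ = ⟨k + 1, by omega⟩)
    (hskip : ∀ p, τ (skip k p) = skip k (σ p)) (ha : ∀ p, a' (skip k p) = a p) :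
    IsCuspQuotient k hk (stdComplex τ hτ a') (stdComplex σ hσ a) := by
  refine isCuspQuotient_of_commute hk (c := a' ⟨k, by omega⟩) (Units.ne_zero _) ?_ fun p => ?_
  · rw [stdComplex_single, hk', if_pos (Fin.lt_def.2 (Nat.lt_succ_self k))]
  · rw [stdComplex_single, stdComplex_single, hskip, ha]
    by_cases hp : p < σ p <;> simp [hp, skip_lt_skip]

/-- Standard complexes persist along an SR-form: the marks around a piece turn a standard complex of
the ruling before the piece into one after it, with coefficients related by `CoeffStep`. Here `b`
says whether the piece carries marks. -/
theorem complexStep_stdComplex {pc : Piece s t} {σ : Equiv.Perm (Fin s)} {τ : Equiv.Perm (Fin t)}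
    (hσ : ∀ p, σ (σ p) = p) (hfix : ∀ p, σ p ≠ p) (hτ : ∀ p, τ (τ p) = p)
    (hstep : pc.RulingStep σ τ) {a : Fin s → Fˣ} {a' : Fin t → Fˣ} {x : Fˣ}
    (ha : pc.CoeffStep σ τ x a a') {r : F}
    (hr : pc.IsSwitch σ τ → r = if pc.IsNestedBelow σ then -(x : F) else x) {b : Prop} [Decidable b]
    (hb : pc.IsSwitch σ τ → b) (hb' : b → pc.CarriesMarks σ τ) :
    pc.ComplexStep (slides (if b then pc.leftMarks r else []) (stdComplex σ hσ a))
      (unslides (if b then pc.rightMarks σ τ (stdComplex σ hσ a) r else [])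
        (stdComplex τ hτ a')) := by
  cases pc with
  | leftCusp k hk =>
    rw [if_neg fun h => (hb' h).not_leftCusp ⟨⟨k, by omega⟩, ⟨k + 1, by omega⟩, rfl, rfl⟩,
      if_neg fun h => (hb' h).not_leftCusp ⟨⟨k, by omega⟩, ⟨k + 1, by omega⟩, rfl, rfl⟩]
    exact isCuspQuotient_stdComplex hk hσ hτ hstep.1 hstep.2 fun p => by
      simpa [IsSwitch] using ha.1 p (skip k p) rfl
  | rightCusp k hk =>
    have h1 : slides (if b then (rightCusp k hk).leftMarks r else []) (stdComplex σ hσ a) =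
        stdComplex σ hσ a := by
      split_ifs
      · exact slide_stdComplex_of_paired hσ a (Fin.lt_def.2 (Nat.lt_succ_self k)) hstep.1
      · rfl
    rw [h1]
    simp only [rightMarks, ite_self, unslides_nil]
    exact isCuspQuotient_stdComplex hk hτ hσ hstep.1 hstep.2 fun p => by
      simpa [IsSwitch] using (ha.1 (skip k p) p rfl).symm
  | crossing k hk =>
    by_cases hs : (crossing k hk).IsSwitch σ τ
    · obtain rfl : σ = τ := hs.1
      rw [if_pos (hb hs), if_pos (hb hs)]
      refine complexStep_switch hσ hfix hs hstep.1 (fun p => ?_) (hr hs)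
        fun h hh => lt_of_mem_rightMarks hfix hstep (.inl hs) hh
      have := ha.1 p p (by simp [RulingJoins, hs])
      rwa [if_pos hs] at this
    · have hστ : τ = cross k hk * σ * cross k hk := hstep.2.resolve_right hs
      have ha' : ∀ p, a' (cross k hk p) = a p := fun p => by
        have := ha.1 p (cross k hk p) (by simp [RulingJoins, hs])
        rwa [if_neg hs, mul_one] at this
      by_cases hb1 : b
      · rw [if_pos hb1, if_pos hb1]
        rcases hb' hb1 with h | h | ⟨u, l, h⟩
        · exact absurd h hs
        · exact complexStep_return hσ hfix hτ h hstep.1 ha'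
            fun h' hh => lt_of_mem_rightMarks hfix hstep (.inr (.inl h)) hh
        · exact h.elim
      · rw [if_neg hb1, if_neg hb1]
        exact complexStep_plain hσ hfix hτ hστ hstep.1 ha'

theorem leftCuspSimple_stdComplex {pc : Piece s t} {σ : Equiv.Perm (Fin s)}
    {τ : Equiv.Perm (Fin t)} (hτ : ∀ p, τ (τ p) = p) (hstep : pc.RulingStep σ τ) {a' : Fin t → Fˣ}
    (ha : ∀ u l, pc.IsLeftCuspAt u l → a' u = 1) (b : Prop) [Decidable b]
    (C : TriComplex F s) (r : F) :
    pc.LeftCuspSimple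
      (unslides (if b then pc.rightMarks σ τ C r else []) (stdComplex τ hτ a')) := by
  cases pc with
  | rightCusp k hk => trivial
  | crossing k hk => trivial
  | leftCusp k hk =>
    simp only [rightMarks, ite_self, unslides_nil]
    have h1 : a' (⟨k, by omega⟩ : Fin (_ + 2)) = 1 := ha _ ⟨k + 1, by omega⟩ ⟨rfl, rfl⟩
    have h2 : τ (⟨k + 1, by omega⟩ : Fin (_ + 2)) = ⟨k, by omega⟩ := by rw [← hstep.1, hτ]
    refine ⟨?_, fun j hj => ?_⟩
    · rw [stdComplex_single, hstep.1, if_pos (Fin.lt_def.2 (Nat.lt_succ_self k)), h1]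
      simp
    · have hj1 : τ j ≠ ⟨k, by omega⟩ := fun e => by
        have := congrArg Fin.val ((congrArg τ e).symm.trans (hτ j))
        rw [hstep.1] at this
        simp only at this
        omega
      have hj2 : τ j ≠ ⟨k + 1, by omega⟩ := fun e => by
        have := congrArg Fin.val ((congrArg τ e).symm.trans (hτ j))
        rw [h2] at this
        simp only at this
        omega
      rw [TriComplex.coeff, TriComplex.coeff, stdComplex_single]
      split_ifs <;> simp [hj1.symm, hj2.symm]

/-- The complex on the right of a piece is determined by the complex on its left, if left cusps are
simple. -/
theorem ComplexStep.unique {pc : Piece s t} {C : TriComplex F s} {C' C'' : TriComplex F t}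
    (h' : pc.ComplexStep C C') (h'' : pc.ComplexStep C C'') (hs' : pc.LeftCuspSimple C')
    (hs'' : pc.LeftCuspSimple C'') : C' = C'' := by
  cases pc with
  | rightCusp k hk => exact IsCuspQuotient.unique_right (hk := hk) h' h''
  | crossing k hk => exact IsComplexIso.unique h' h''
  | leftCusp k hk => exact IsCuspQuotient.unique_left h' h'' hs' hs''

/-- The coefficient conditions of a Morse complex sequence only have to be checked at right cusps:
next to a crossing they follow from the triangularity of the differentials on the two sides. -/
theorem coeffCondition_of_complexStep {s t : ℕ} {pc : Piece s t} {C : TriComplex F s}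
    {C' : TriComplex F t}
    (h : pc.ComplexStep C C') (hl : pc.LeftCuspSimple C') {marked : Prop}
    (hr : ∀ u l, pc.IsRightCuspAt u l →
      if marked then ∃ v : Fˣ, C.coeff u l = -(v : F) else C.coeff u l = -1) :
    pc.CoeffCondition marked C C' := by
  cases pc with
  | rightCusp k hk => exact hr _ _ ⟨rfl, rfl⟩
  | leftCusp k hk =>
    show C'.d _ _ = 1
    rw [hl.1]
    simp
  | crossing k hk =>
    have key : ∀ p q, C'.coeff (cross k hk p) (cross k hk q) = C.coeff p q := by
      intro p q
      have e := congrFun (LinearMap.congr_fun h.2 (Pi.single p 1)) (cross k hk q)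
      simp only [LinearMap.comp_apply, onBasis_single] at e
      rw [TriComplex.coeff, ← e, LinearMap.pi_apply_eq_sum_univ (onBasis _), Finset.sum_apply]
      have : ∀ i : Fin s, (fun j => if i = j then (1 : F) else 0) = Pi.single i 1 := fun i => by
        ext j; simp [Pi.single_apply, eq_comm]
      simp [this, Pi.single_apply, TriComplex.coeff]
    have hlt : ¬ (⟨k + 1, hk⟩ : Fin _) < ⟨k, by omega⟩ := by simp [Fin.lt_def]
    have h1 := key ⟨k, by omega⟩ ⟨k + 1, hk⟩
    have h2 := key ⟨k + 1, hk⟩ ⟨k, by omega⟩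
    simp only [cross, Equiv.swap_apply_left, Equiv.swap_apply_right] at h1 h2
    exact ⟨h1.symm.trans (C'.triangular _ _ hlt), h2.trans (C.triangular _ _ hlt)⟩

theorem CoeffCondition.rightCusp {pc : Piece s t} {C : TriComplex F s} {C' : TriComplex F t}
    {marked : Prop} (h : pc.CoeffCondition marked C C') {u l : Fin s} (hc : pc.IsRightCuspAt u l) :
    if marked then ∃ v : Fˣ, C.coeff u l = -(v : F) else C.coeff u l = -1 := by
  cases pc with
  | leftCusp k hk => exact hc.elim
  | crossing k hk => exact hc.elim
  | rightCusp k hk =>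
    rw [show u = ⟨k, by omega⟩ from Fin.ext hc.1, show l = ⟨k + 1, by omega⟩ from Fin.ext hc.2]
    exact h

/-- The mark before a right cusp does not change the standard complex. -/
theorem slides_leftMarks_of_rightCusp {pc : Piece s t} {σ : Equiv.Perm (Fin s)}
    {τ : Equiv.Perm (Fin t)} (hσ : ∀ p, σ (σ p) = p) (hstep : pc.RulingStep σ τ) (a : Fin s → Fˣ)
    {u l : Fin s} (hc : pc.IsRightCuspAt u l) (b : Prop) [Decidable b] (r : F) :
    slides (if b then pc.leftMarks r else []) (stdComplex σ hσ a) = stdComplex σ hσ a := by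
  cases pc with
  | leftCusp k hk => exact hc.elim
  | crossing k hk => exact hc.elim
  | rightCusp k hk =>
    split_ifs
    · exact slide_stdComplex_of_paired hσ a (Fin.lt_def.2 (Nat.lt_succ_self k)) hstep.1
    · rfl

/-! ### Degrees -/

theorem degree_eq_of_mem_leftMarks {R A : Type*} {pc : Piece s t} {g : Fin s → A}
    (hX : ∀ u l, pc.IsCrossingAt u l → g u = g l)
    (hR : (∃ u l, pc.IsRightCuspAt u l) → Subsingleton A) {r : R}
    {h : Handleslide R s}
    (hh : h ∈ pc.leftMarks r) : g h.upper = g h.lower := by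
  cases pc with
  | leftCusp k hk => simp [leftMarks] at hh
  | rightCusp k hk =>
    have := hR ⟨⟨k, by omega⟩, ⟨k + 1, by omega⟩, rfl, rfl⟩
    exact Subsingleton.elim _ _
  | crossing k hk =>
    rw [leftMarks, List.mem_singleton] at hh
    rw [hh]
    exact hX _ _ ⟨rfl, rfl⟩

section Degrees

variable {A : Type*} [AddCommGroup A] [One A] {pc : Piece s t} {σ : Equiv.Perm (Fin s)}
  {τ : Equiv.Perm (Fin t)} {g : Fin s → A} {g' : Fin t → A}

/-- In an `m`-graded ruling the degrees of paired strands differ by one: this passes from the left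
of a piece to its right. -/
theorem degree_companion_step (hσ : ∀ p, σ (σ p) = p) (hfix : ∀ p, σ p ≠ p)
    (hτ : ∀ p, τ (τ p) = p) (hstep : pc.RulingStep σ τ)
    (hJ : ∀ p q, pc.Joins p q → g p = g' q) (hL : ∀ u l, pc.IsLeftCuspAt u l → g' u = g' l + 1)
    (hS : pc.IsSwitch σ τ → ∀ u l, pc.IsCrossingAt u l → g u = g l)
    (hg : ∀ p, p < σ p → g (σ p) = g p - 1) (q : Fin t) (hq : q < τ q) :
    g' (τ q) = g' q - 1 := by
  cases pc with
  | rightCusp k hk =>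
    have h := hg (skip k q) (by rw [hstep.2, skip_lt_skip]; exact hq)
    rw [hstep.2] at h
    rw [← hJ _ _ rfl, ← hJ _ _ rfl, h]
  | leftCusp k hk =>
    have h1 := hL (⟨k, by omega⟩ : Fin (_ + 2)) ⟨k + 1, by omega⟩ ⟨rfl, rfl⟩
    by_cases c1 : (q : ℕ) = k
    · rw [show q = ⟨k, by omega⟩ from Fin.ext c1, hstep.1, h1]
      abel
    by_cases c2 : (q : ℕ) = k + 1
    · have h2 : τ (⟨k + 1, by omega⟩ : Fin (_ + 2)) = ⟨k, by omega⟩ := by rw [← hstep.1, hτ]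
      rw [show q = ⟨k + 1, by omega⟩ from Fin.ext c2, h2] at hq
      exact absurd hq (by simp [Fin.lt_def])
    obtain ⟨p, rfl⟩ := exists_skip_eq c1 c2 hk
    rw [hstep.2, skip_lt_skip] at hq
    rw [hstep.2, ← hJ _ _ rfl, ← hJ _ _ rfl, hg p hq]
  | crossing k hk =>
    have hJ' : ∀ p, g' (cross k hk p) = g p := fun p => (hJ p _ rfl).symm
    by_cases hs : (crossing k hk).IsSwitch σ τ
    · have h0 := hS hs ⟨k, by omega⟩ ⟨k + 1, hk⟩ ⟨rfl, rfl⟩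
      have h1 : ∀ p, g' p = g p := by
        intro p
        obtain ⟨p, rfl⟩ := (cross k hk).surjective p
        rw [hJ', cross, Equiv.swap_apply_def]
        split_ifs with e1 e2
        · rw [e1, h0]
        · rw [e2, h0]
        · rfl
      rw [h1, h1]
      rw [← hs.1] at hq ⊢
      exact hg q hq
    · have hστ : τ = cross k hk * σ * cross k hk := hstep.2.resolve_right hs
      obtain ⟨p, rfl⟩ := (cross k hk).surjective q
      have h1 : τ (cross k hk p) = cross k hk (σ p) := by rw [hστ]; simp [cross]
      rw [h1] at hq ⊢
      rw [hJ', hJ']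
      refine hg p ?_
      rwa [cross, swap_lt_swap_iff rfl (hfix p).symm] at hq
      · rintro ⟨rfl, h⟩; exact hstep.1 h
      · rintro ⟨rfl, h⟩; exact hstep.1 (by rw [← h, hσ])

theorem degree_eq_of_mem_rightMarks (hfix : ∀ p, σ p ≠ p) (hτ : ∀ p, τ (τ p) = p)
    (hstep : pc.RulingStep σ τ) (hm : pc.CarriesMarks σ τ)
    (hJ : ∀ p q, pc.Joins p q → g p = g' q) (hX : ∀ u l, pc.IsCrossingAt u l → g u = g l)
    (hg' : ∀ q, q < τ q → g' (τ q) = g' q - 1) {C : TriComplex F s} {r : F}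
    {h : Handleslide F t} (hh : h ∈ pc.rightMarks σ τ C r) : g' h.upper = g' h.lower := by
  cases pc with
  | leftCusp k hk => simp [rightMarks] at hh
  | rightCusp k hk => simp [rightMarks] at hh
  | crossing k hk =>
    have h0 : g' ⟨k, by omega⟩ = g' ⟨k + 1, hk⟩ := by
      rw [← hJ ⟨k + 1, hk⟩ ⟨k, by omega⟩ (by simp [Joins, cross]),
        ← hJ ⟨k, by omega⟩ ⟨k + 1, hk⟩ (by simp [Joins, cross])]
      exact (hX _ _ ⟨rfl, rfl⟩).symm
    rcases mem_rightMarks rfl rfl hfix hstep hm hh with ⟨h1, h2⟩ | ⟨h1, h2, h3 | h3⟩ <;> rw [h1, h2]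
    · exact h0
    · have e1 := hg' (τ ⟨k, by omega⟩) (by rw [hτ]; exact h3.2)
      have e2 := hg' (τ ⟨k + 1, hk⟩) (by
        rw [hτ]; exact h3.1.trans (h3.2.trans (Fin.lt_def.2 (Nat.lt_succ_self k))))
      rw [hτ] at e1 e2
      rw [← sub_left_inj (a := (1 : A)), ← e1, ← e2, h0]
    · rw [hg' _ h3.1, hg' _ ((Fin.lt_def.2 (Nat.lt_succ_self k)).trans (h3.1.trans h3.2)), h0]

end Degrees

end Piece

end Legendrian

namespace Legendrian.FrontDiagram

namespace NormalRuling

variable {D : FrontDiagram} (ρ : D.NormalRuling)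

/-! ### The disks of a normal ruling -/

/-- The event at which the disk bounded by a strand begins, computed from left to right. -/
def start (i : Fin (D.numEvents + 1)) : Fin (D.strands i) → ℕ :=
  Fin.induction (motive := fun i => Fin (D.strands i) → ℕ) (fun _ => 0)
    (fun i g q => if h : ∃ p, (D.piece i).RulingJoins (ρ.pairing i.castSucc) (ρ.pairing i.succ) p q
      then g h.choose else i) i

theorem start_succ (i : Fin D.numEvents) (q : Fin (D.strands i.succ)) :
    ρ.start i.succ q =
      if h : ∃ p, (D.piece i).RulingJoins (ρ.pairing i.castSucc) (ρ.pairing i.succ) p q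
      then ρ.start i.castSucc h.choose else i := by
  simp only [start, Fin.induction_succ]

theorem start_of_rulingJoins {i : Fin D.numEvents} {p : Fin (D.strands i.castSucc)}
    {q : Fin (D.strands i.succ)}
    (h : (D.piece i).RulingJoins (ρ.pairing i.castSucc) (ρ.pairing i.succ) p q) :
    ρ.start i.succ q = ρ.start i.castSucc p := by
  have hex : ∃ p, (D.piece i).RulingJoins (ρ.pairing i.castSucc) (ρ.pairing i.succ) p q := ⟨p, h⟩
  rw [start_succ, dif_pos hex, Piece.rulingJoins_left_unique hex.choose_spec h]

theorem start_of_not_rulingJoins {i : Fin D.numEvents} {q : Fin (D.strands i.succ)}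
    (h : ¬ ∃ p, (D.piece i).RulingJoins (ρ.pairing i.castSucc) (ρ.pairing i.succ) p q) :
    ρ.start i.succ q = i := by
  rw [start_succ, dif_neg h]

theorem not_strand_zero (p : Fin (D.strands 0)) : False :=
  Nat.not_lt_zero _ (p.2.trans_eq D.strands_first)

theorem start_lt (i : Fin (D.numEvents + 1)) (p : Fin (D.strands i)) : ρ.start i p < i := by
  induction i using Fin.induction with
  | zero => exact (not_strand_zero p).elim
  | succ i ih =>
    by_cases h : ∃ p', (D.piece i).RulingJoins (ρ.pairing i.castSucc) (ρ.pairing i.succ) p' p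
    · obtain ⟨p', h⟩ := h
      rw [ρ.start_of_rulingJoins h]
      exact (ih p').trans (Nat.lt_succ_self i)
    · rw [ρ.start_of_not_rulingJoins h]
      exact Nat.lt_succ_self i

theorem start_companion (i : Fin (D.numEvents + 1)) (p : Fin (D.strands i)) :
    ρ.start i (ρ.pairing i p) = ρ.start i p := by
  induction i using Fin.induction with
  | zero => exact (not_strand_zero p).elim
  | succ i ih =>
    by_cases h : ∃ p', (D.piece i).RulingJoins (ρ.pairing i.castSucc) (ρ.pairing i.succ) p' p
    · obtain ⟨p', h⟩ := h
      rw [ρ.start_of_rulingJoins h, ρ.start_of_rulingJoins (h.companion (ρ.step i)), ih]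
    · rw [ρ.start_of_not_rulingJoins h, ρ.start_of_not_rulingJoins]
      rintro ⟨p', h'⟩
      have := h'.companion (ρ.step i)
      rw [ρ.involutive] at this
      exact h ⟨_, this⟩

/-- Over one strip, only paired strands belong to disks with the same starting event. -/
theorem eq_or_eq_companion_of_start_eq (i : Fin (D.numEvents + 1)) {p q : Fin (D.strands i)}
    (h : ρ.start i p = ρ.start i q) : q = p ∨ q = ρ.pairing i p := by
  induction i using Fin.induction with
  | zero => exact (not_strand_zero p).elim
  | succ i ih =>
    by_cases hp : ∃ p', (D.piece i).RulingJoins (ρ.pairing i.castSucc) (ρ.pairing i.succ) p' p <;>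
    by_cases hq : ∃ q', (D.piece i).RulingJoins (ρ.pairing i.castSucc) (ρ.pairing i.succ) q' q
    · obtain ⟨p', hp⟩ := hp
      obtain ⟨q', hq⟩ := hq
      rw [ρ.start_of_rulingJoins hp, ρ.start_of_rulingJoins hq] at h
      rcases ih h with e | e
      · subst e; exact .inl (Piece.rulingJoins_right_unique hq hp)
      · subst e; exact .inr (Piece.rulingJoins_right_unique hq (hp.companion (ρ.step i)))
    · obtain ⟨p', hp⟩ := hp
      rw [ρ.start_of_rulingJoins hp, ρ.start_of_not_rulingJoins hq] at h
      exact absurd h (ρ.start_lt i.castSucc p').ne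
    · obtain ⟨q', hq⟩ := hq
      rw [ρ.start_of_rulingJoins hq, ρ.start_of_not_rulingJoins hp] at h
      exact absurd h (ρ.start_lt i.castSucc q').ne'
    · exact Piece.eq_or_eq_companion_of_no_left (ρ.involutive i.succ) (ρ.step i) hp hq

/-- The event at which a disk begins. -/
def diskStart : ρ.Disk → ℕ :=
  Quot.lift (fun a : D.Strand => ρ.start a.1 a.2) fun a b h => by
    cases h with
    | companion i p => exact (ρ.start_companion i p).symm
    | through i p q h => exact (ρ.start_of_rulingJoins h).symm

@[simp]
theorem diskStart_disk (i : Fin (D.numEvents + 1)) (p : Fin (D.strands i)) :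
    ρ.diskStart (ρ.disk ⟨i, p⟩) = ρ.start i p := rfl

theorem disk_companion (i : Fin (D.numEvents + 1)) (p : Fin (D.strands i)) :
    ρ.disk ⟨i, ρ.pairing i p⟩ = ρ.disk ⟨i, p⟩ :=
  (Quot.sound (DiskAdjacent.companion i p)).symm

theorem disk_of_rulingJoins {i : Fin D.numEvents} {p : Fin (D.strands i.castSucc)}
    {q : Fin (D.strands i.succ)}
    (h : (D.piece i).RulingJoins (ρ.pairing i.castSucc) (ρ.pairing i.succ) p q) :
    ρ.disk ⟨i.succ, q⟩ = ρ.disk ⟨i.castSucc, p⟩ :=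
  (Quot.sound (DiskAdjacent.through i p q h)).symm

theorem disk_eq_iff {i : Fin (D.numEvents + 1)} {p q : Fin (D.strands i)} :
    ρ.disk ⟨i, q⟩ = ρ.disk ⟨i, p⟩ ↔ q = p ∨ q = ρ.pairing i p := by
  refine ⟨fun h => ρ.eq_or_eq_companion_of_start_eq i (congrArg ρ.diskStart h).symm, ?_⟩
  rintro (rfl | rfl)
  · rfl
  · exact ρ.disk_companion i p

/-- A disk does not reappear on the right of the right cusp at which it ends. -/
theorem start_ne_of_rightCusp {e : Fin D.numEvents} {u l : Fin (D.strands e.castSucc)}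
    (hc : (D.piece e).IsRightCuspAt u l) (i : Fin (D.numEvents + 1)) (hi : (e : ℕ) < i)
    (q : Fin (D.strands i)) : ρ.start i q ≠ ρ.start e.castSucc u := by
  induction i using Fin.induction with
  | zero => exact absurd hi (Nat.not_lt_zero _)
  | succ i ih =>
    have hei : (e : ℕ) ≤ i := Nat.lt_succ_iff.1 hi
    by_cases h : ∃ p, (D.piece i).RulingJoins (ρ.pairing i.castSucc) (ρ.pairing i.succ) p q
    · obtain ⟨p, h⟩ := h
      rw [ρ.start_of_rulingJoins h]
      rcases hei.lt_or_eq with hlt | heq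
      · exact ih hlt p
      · obtain rfl : e = i := Fin.ext heq
        intro hs
        rcases ρ.eq_or_eq_companion_of_start_eq e.castSucc hs with e' | e'
        · subst e'; exact hc.no_right q h
        · have h' := h.companion (ρ.step e)
          rw [← e'] at h'
          exact hc.no_right _ h'
    · rw [ρ.start_of_not_rulingJoins h]
      exact ((ρ.start_lt e.castSucc u).trans_le hei).ne'

/-- Every disk ends at a right cusp. -/
theorem exists_endsAt (δ : ρ.Disk) : ∃ e, ρ.EndsAt δ e := by
  induction δ using Quot.ind with
  | mk a =>
    obtain ⟨i, p⟩ := a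
    induction i using Fin.reverseInduction with
    | last => exact absurd (p.2.trans_eq D.strands_last) (Nat.not_lt_zero _)
    | cast i ih =>
      rcases (D.piece i).exists_rulingJoins_or_rightCusp (ρ.pairing i.castSucc) (ρ.pairing i.succ) p
        with ⟨q, h⟩ | ⟨u, l, hc, hp⟩
      · obtain ⟨e, he⟩ := ih q
        refine ⟨e, ?_⟩
        have := ρ.disk_of_rulingJoins h
        unfold disk at this
        rwa [this] at he
      · refine ⟨i, u, l, hc, ?_⟩
        show ρ.disk _ = ρ.disk _
        rw [disk_eq_iff]
        rcases hp with rfl | rfl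
        · exact .inl rfl
        · rw [← hc.companion (ρ.step i), ρ.involutive]; exact .inr rfl

/-- A disk ends at only one right cusp. -/
theorem EndsAt.unique {δ : ρ.Disk} {e e' : Fin D.numEvents} (h : ρ.EndsAt δ e)
    (h' : ρ.EndsAt δ e') : e = e' := by
  have key : ∀ {e e' : Fin D.numEvents}, ρ.EndsAt δ e → ρ.EndsAt δ e' → ¬ (e : ℕ) < e' := by
    rintro e e' ⟨u, l, hc, rfl⟩ ⟨u', l', hc', hd⟩ hlt
    exact ρ.start_ne_of_rightCusp hc e'.castSucc hlt u' (congrArg ρ.diskStart hd)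
  exact Fin.ext (le_antisymm (not_lt.1 (key h' h)) (not_lt.1 (key h h')))

/-! ### The disk coefficients -/

variable {F : Type*} [Field F] (x : ρ.Switch → Fˣ)

/-- The product of the factors of the disk equation of `δ` at the switches on the left of the `i`-th
strip. -/
def partialProduct (i : ℕ) (δ : ρ.Disk) : Fˣ :=
  ∏ j : ρ.Switch, if (j.1 : ℕ) < i then (D.piece j.1).diskFactor (ρ.pairing j.1.castSucc)
    (fun p => ρ.disk ⟨j.1.castSucc, p⟩ = δ) (x j) else 1

/-- The variable of the `i`-th event if this is a switch, and `1` otherwise. -/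
def switchVar (i : Fin D.numEvents) : Fˣ := if h : ρ.IsSwitch i then x ⟨i, h⟩ else 1

theorem partialProduct_succ (i : Fin D.numEvents) (δ : ρ.Disk) :
    ρ.partialProduct x (i + 1) δ = ρ.partialProduct x i δ *
      if ρ.IsSwitch i then (D.piece i).diskFactor (ρ.pairing i.castSucc)
        (fun p => ρ.disk ⟨i.castSucc, p⟩ = δ) (ρ.switchVar x i) else 1 := by
  have h1 : ρ.partialProduct x (i + 1) δ = ρ.partialProduct x i δ *
      ∏ j : ρ.Switch, if j.1 = i then (D.piece j.1).diskFactor (ρ.pairing j.1.castSucc)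
        (fun p => ρ.disk ⟨j.1.castSucc, p⟩ = δ) (x j) else 1 := by
    rw [partialProduct, partialProduct, ← Finset.prod_mul_distrib]
    refine Finset.prod_congr rfl fun j _ => ?_
    by_cases h2 : j.1 = i
    · simp [h2]
    · have h3 : (j.1 : ℕ) ≠ i := fun e => h2 (Fin.ext e)
      have h4 : (j.1 : ℕ) < i + 1 ↔ (j.1 : ℕ) < i := by omega
      simp [h2, h4]
  rw [h1]
  congr 1
  by_cases hs : ρ.IsSwitch i
  · rw [if_pos hs, Finset.prod_eq_single (⟨i, hs⟩ : ρ.Switch)]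
    · simp [switchVar, hs]
    · intro j _ hj
      exact if_neg fun e => hj (Subtype.ext e)
    · exact fun h => absurd (Finset.mem_univ _) h
  · rw [if_neg hs]
    refine Finset.prod_eq_one fun j _ => if_neg ?_
    rintro rfl
    exact hs j.2

/-- The coefficient, over the `i`-th strip, of the disk bounded by a strand. -/
def diskCoeff (i : Fin (D.numEvents + 1)) (p : Fin (D.strands i)) : Fˣ :=
  ρ.partialProduct x i (ρ.disk ⟨i, p⟩)

theorem coeffStep_diskCoeff (i : Fin D.numEvents) :
    (D.piece i).CoeffStep (ρ.pairing i.castSucc) (ρ.pairing i.succ) (ρ.switchVar x i)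
      (ρ.diskCoeff x i.castSucc) (ρ.diskCoeff x i.succ) := by
  refine ⟨fun p q h => ?_, fun u l h => ?_⟩
  · rw [diskCoeff, diskCoeff, ρ.disk_of_rulingJoins h, Fin.val_succ, partialProduct_succ]
    simp only [disk_eq_iff]
    rfl
  · rw [diskCoeff, partialProduct]
    refine Finset.prod_eq_one fun j _ => ?_
    split_ifs with hj
    · refine Piece.diskFactor_eq_one (fun p hp => ?_) _
      -- the disk which begins at the `i`-th event does not occur at earlier events
      have h1 := congrArg ρ.diskStart hp
      rw [diskStart_disk, diskStart_disk,
        ρ.start_of_not_rulingJoins (fun ⟨p, hp⟩ => h.no_left p hp)] at h1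
      have h2 := ρ.start_lt j.1.castSucc p
      rw [h1] at h2
      rw [Fin.val_succ] at hj
      rw [Fin.val_castSucc] at h2
      omega
    · rfl

/-- The disk coefficient at the right cusp of a disk is the left-hand side of its disk equation. -/
theorem diskCoeff_eq_diskProduct {i : Fin D.numEvents} {u l : Fin (D.strands i.castSucc)}
    (hc : (D.piece i).IsRightCuspAt u l) :
    ρ.diskCoeff x i.castSucc u = ρ.diskProduct x (ρ.disk ⟨i.castSucc, u⟩) := by
  rw [diskCoeff, partialProduct, diskProduct]
  refine Finset.prod_congr rfl fun j _ => ?_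
  split_ifs with hj
  · rfl
  · refine (Piece.diskFactor_eq_one (fun p hp => ?_) _).symm
    rcases (not_lt.1 hj).lt_or_eq with hlt | heq
    · exact ρ.start_ne_of_rightCusp hc j.1.castSucc hlt p (congrArg ρ.diskStart hp)
    · have : i = j.1 := Fin.ext heq
      subst this
      exact hc.not_isSwitch j.2

/-! ### Gradings -/

variable {N m : ℕ} {μ : D.MaslovPotential N} {hm : m ∣ N}

theorem _root_.Legendrian.FrontDiagram.MaslovPotential.CrossingDegreeZero.reduce_eq
    {i : Fin D.numEvents} (h : μ.CrossingDegreeZero hm i) {u l : Fin (D.strands i.castSucc)}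
    (hc : (D.piece i).IsCrossingAt u l) :
    μ.reduce hm ⟨i.castSucc, u⟩ = μ.reduce hm ⟨i.castSucc, l⟩ := by
  obtain ⟨u', l', hc', h0⟩ := h
  obtain ⟨rfl, rfl⟩ := hc.unique hc'
  rw [map_sub, sub_eq_zero] at h0
  exact h0

variable {ρ}

/-- In an `m`-graded ruling the degrees of paired strands differ by one. -/
theorem IsGraded.reduce_companion (hρ : ρ.IsGraded μ hm) (i : Fin (D.numEvents + 1))
    (p : Fin (D.strands i)) (hp : p < ρ.pairing i p) :
    μ.reduce hm ⟨i, ρ.pairing i p⟩ = μ.reduce hm ⟨i, p⟩ - 1 := by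
  induction i using Fin.induction with
  | zero => exact (not_strand_zero p).elim
  | succ i ih =>
    refine Piece.degree_companion_step (g := fun p => μ.reduce hm ⟨i.castSucc, p⟩)
      (g' := fun p => μ.reduce hm ⟨i.succ, p⟩) (ρ.involutive i.castSucc)
      (ρ.fixedPointFree i.castSucc) (ρ.involutive i.succ) (ρ.step i) ?_ ?_ ?_ ih p hp
    · intro p q h
      exact congrArg (ZMod.castHom hm (ZMod m)) (μ.through i p q h)
    · intro u l h
      simp only [MaslovPotential.reduce, μ.leftCusp i u l h, map_add, map_one]
    · intro h u l hc
      exact (hρ i h).reduce_eq hc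

end NormalRuling

/-! ### Generalities on Morse complex sequences -/

namespace MCS

variable {D : FrontDiagram} {M : D.MarkedPoints} {F : Type*} [Field F]

theorem ext_of_cx {C C' : D.MCS M F} (hm : ∀ i, C.marks i = C'.marks i)
    (hc : ∀ i (j : ℕ) (h : j < (C.marks i).length + 1) (h' : j < (C'.marks i).length + 1),
      C.cx i ⟨j, h⟩ = C'.cx i ⟨j, h'⟩) : C = C' := by
  obtain ⟨marks, _, cx, _, _, _⟩ := C
  obtain ⟨marks', _, cx', _, _, _⟩ := C'
  obtain rfl : marks = marks' := funext hm
  obtain rfl : cx = cx' := funext fun i => funext fun j => hc i j j.2 j.2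
  rfl

theorem cx_eq_slides (C : D.MCS M F) (i : Fin (D.numEvents + 1)) (j : ℕ)
    (hj : j < (C.marks i).length + 1) :
    C.cx i ⟨j, hj⟩ = slides ((C.marks i).take j) (C.cx i 0) := by
  induction j with
  | zero => rfl
  | succ j ih =>
    have hj' : j < (C.marks i).length := by omega
    have h1 := C.slide i ⟨j, hj'⟩
    have hlt := C.marks_lt i _ ((C.marks i).get_mem ⟨j, hj'⟩)
    rw [List.take_succ_eq_append_getElem hj', slides_append, ← ih (by omega)]
    exact h1.unique (isComplexIso_slide _ hlt _)

end MCS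

namespace NormalRuling

variable {D : FrontDiagram} {N m : ℕ} (ρ : D.NormalRuling) (μ : D.MaslovPotential N) (hm : m ∣ N)
  {F : Type*} [Field F] {M : D.MarkedPoints}

/-! ### The marks and complexes of an SR-form -/

/-- The `i`-th event carries handleslide marks in an SR-form. -/
abbrev HasMarks (i : Fin D.numEvents) : Prop := ρ.IsSwitch i ∨ ρ.IsGradedReturnOrCusp μ hm i

variable {ρ μ hm} in
theorem HasMarks.carriesMarks {i : Fin D.numEvents} (h : ρ.HasMarks μ hm i) :
    (D.piece i).CarriesMarks (ρ.pairing i.castSucc) (ρ.pairing i.succ) := by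
  rcases h with h | ⟨h, -⟩ | ⟨-, h⟩
  · exact .inl h
  · exact .inr (.inl h)
  · exact .inr (.inr h)

variable {ρ μ hm} in
theorem not_isSwitch_of_isGradedReturnOrCusp {i : Fin D.numEvents}
    (h : ρ.IsGradedReturnOrCusp μ hm i) : ¬ ρ.IsSwitch i := by
  rcases h with ⟨h, -⟩ | ⟨-, u, l, h⟩
  · exact Piece.not_isSwitch_of_isReturn (ρ.fixedPointFree _) (ρ.step i) h
  · exact h.not_isSwitch

variable {ρ μ hm} in
theorem HasMarks.reduce_eq (hρ : ρ.IsGraded μ hm) {i : Fin D.numEvents} (h : ρ.HasMarks μ hm i)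
    {u l : Fin (D.strands i.castSucc)} (hc : (D.piece i).IsCrossingAt u l) :
    μ.reduce hm ⟨i.castSucc, u⟩ = μ.reduce hm ⟨i.castSucc, l⟩ := by
  rcases h with h | ⟨-, h⟩ | ⟨-, u', l', h⟩
  · exact (hρ i h).reduce_eq hc
  · exact h.reduce_eq hc
  · exact absurd hc h.not_isCrossingAt

variable {ρ μ hm} in
theorem HasMarks.eq_one {i : Fin D.numEvents} (h : ρ.HasMarks μ hm i)
    {u l : Fin (D.strands i.castSucc)} (hc : (D.piece i).IsRightCuspAt u l) : m = 1 := by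
  rcases h with h | ⟨h, -⟩ | ⟨h, -⟩
  · exact absurd h hc.not_isSwitch
  · exact absurd h hc.not_isReturn
  · exact h

variable (x : ρ.Switch → Fˣ) (r : Fin D.numEvents → F)

/-- The standard complex over a strip determined by the variables of the switches. -/
def stripComplex (i : Fin (D.numEvents + 1)) : TriComplex F (D.strands i) :=
  stdComplex (ρ.pairing i) (ρ.involutive i) (ρ.diskCoeff x i)

/-- The marks of an SR-form on the right of an event, computed from the standard complex before the
event. -/
def eventMarksAfter (i : Fin D.numEvents) : List (Handleslide F (D.strands i.succ)) :=
  if ρ.HasMarks μ hm i then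
    (D.piece i).rightMarks (ρ.pairing i.castSucc) (ρ.pairing i.succ) (ρ.stripComplex x i.castSucc)
      (r i)
  else []

/-- The marks over a strip which belong to the event at its left end. -/
def stripMarksAfter (i : Fin (D.numEvents + 1)) : List (Handleslide F (D.strands i)) :=
  Fin.cases (motive := fun i => List (Handleslide F (D.strands i))) []
    (ρ.eventMarksAfter μ hm x r) i

/-- The marks over a strip which belong to the event at its right end. -/
def stripMarksBefore {R : Type*} (r : Fin D.numEvents → R) (i : Fin (D.numEvents + 1)) :
    List (Handleslide R (D.strands i)) :=
  Fin.lastCases (motive := fun i => List (Handleslide R (D.strands i))) []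
    (MCS.marksBefore ρ μ hm r) i

/-- The marks over a strip in the SR-form with the given coefficients. -/
def stripMarks (i : Fin (D.numEvents + 1)) : List (Handleslide F (D.strands i)) :=
  ρ.stripMarksAfter μ hm x r i ++ ρ.stripMarksBefore μ hm r i

/-- The complexes over a strip in the SR-form with the given coefficients: between the marks which
belong to the event at its left end and those which belong to the event at its right end the complex
is standard. -/
def stripCx (i : Fin (D.numEvents + 1)) (j : ℕ) : TriComplex F (D.strands i) :=
  slides ((ρ.stripMarks μ hm x r i).take j)
    (unslides (ρ.stripMarksAfter μ hm x r i) (ρ.stripComplex x i))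

theorem stripMarksAfter_succ (i : Fin D.numEvents) :
    ρ.stripMarksAfter μ hm x r i.succ = ρ.eventMarksAfter μ hm x r i := rfl

theorem stripMarksBefore_castSucc {R : Type*} (r : Fin D.numEvents → R) (i : Fin D.numEvents) :
    ρ.stripMarksBefore μ hm r i.castSucc =
      if ρ.HasMarks μ hm i then (D.piece i).leftMarks (r i) else [] := by
  simp only [stripMarksBefore, Fin.lastCases_castSucc]
  rfl

theorem stripCx_succ_zero (i : Fin D.numEvents) :
    ρ.stripCx μ hm x r i.succ 0 =
      unslides (ρ.eventMarksAfter μ hm x r i) (ρ.stripComplex x i.succ) := rfl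

theorem stripCx_castSucc_length (i : Fin D.numEvents) :
    ρ.stripCx μ hm x r i.castSucc (ρ.stripMarks μ hm x r i.castSucc).length =
      slides (if ρ.HasMarks μ hm i then (D.piece i).leftMarks (r i) else [])
        (ρ.stripComplex x i.castSucc) := by
  rw [stripCx, List.take_length, stripMarks, slides_append, slides_unslides,
    stripMarksBefore_castSucc]

/-- The complex to the left of the first mark before an event is standard. -/
theorem stripCx_castSucc_pred_length {i : Fin D.numEvents} (h : ρ.HasMarks μ hm i) :
    ρ.stripCx μ hm x r i.castSucc ((ρ.stripMarks μ hm x r i.castSucc).length - 1) =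
      ρ.stripComplex x i.castSucc := by
  rw [stripCx, stripMarks, stripMarksBefore_castSucc, if_pos h, List.length_append,
    Piece.length_leftMarks h.carriesMarks.not_leftCusp, Nat.add_sub_cancel, List.take_left,
    slides_unslides]

theorem lt_of_mem_stripMarks {i : Fin (D.numEvents + 1)} {h : Handleslide F (D.strands i)}
    (hh : h ∈ ρ.stripMarks μ hm x r i) : h.upper < h.lower := by
  rw [stripMarks, List.mem_append] at hh
  rcases hh with hh | hh
  · induction i using Fin.cases with
    | zero => simp [stripMarksAfter] at hh
    | succ i =>
      rw [stripMarksAfter_succ, eventMarksAfter] at hh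
      split_ifs at hh with hi
      · exact Piece.lt_of_mem_rightMarks (ρ.fixedPointFree _) (ρ.step i) hi.carriesMarks hh
      · simp at hh
  · induction i using Fin.lastCases with
    | last => simp [stripMarksBefore] at hh
    | cast i =>
      rw [stripMarksBefore_castSucc] at hh
      split_ifs at hh
      · exact Piece.lt_of_mem_leftMarks hh
      · simp at hh

variable {ρ μ hm} in
theorem reduce_eq_of_mem_stripMarksAfter (hρ : ρ.IsGraded μ hm) {i : Fin (D.numEvents + 1)}
    {h : Handleslide F (D.strands i)} (hh : h ∈ ρ.stripMarksAfter μ hm x r i) :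
    μ.reduce hm ⟨i, h.upper⟩ = μ.reduce hm ⟨i, h.lower⟩ := by
  induction i using Fin.cases with
  | zero => simp [stripMarksAfter] at hh
  | succ i =>
    rw [stripMarksAfter_succ, eventMarksAfter] at hh
    split_ifs at hh with hi
    · exact Piece.degree_eq_of_mem_rightMarks (g := fun p => μ.reduce hm ⟨i.castSucc, p⟩)
        (g' := fun p => μ.reduce hm ⟨i.succ, p⟩) (ρ.fixedPointFree _) (ρ.involutive _) (ρ.step i)
        hi.carriesMarks (fun p q h => congrArg (ZMod.castHom hm (ZMod m)) (μ.through i p q h))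
        (fun u l hc => hi.reduce_eq hρ hc) (hρ.reduce_companion i.succ) hh
    · simp at hh

variable {ρ μ hm} in
theorem reduce_eq_of_mem_stripMarksBefore {R : Type*} (r : Fin D.numEvents → R)
    (hρ : ρ.IsGraded μ hm) {i : Fin (D.numEvents + 1)} {h : Handleslide R (D.strands i)}
    (hh : h ∈ ρ.stripMarksBefore μ hm r i) :
    μ.reduce hm ⟨i, h.upper⟩ = μ.reduce hm ⟨i, h.lower⟩ := by
  induction i using Fin.lastCases with
  | last => simp [stripMarksBefore] at hh
  | cast i =>
    rw [stripMarksBefore_castSucc] at hh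
    split_ifs at hh with hi
    · refine Piece.degree_eq_of_mem_leftMarks (g := fun p => μ.reduce hm ⟨i.castSucc, p⟩)
        (fun u l hc => hi.reduce_eq hρ hc) ?_ hh
      rintro ⟨u, l, hc⟩
      rw [hi.eq_one hc]
      exact inferInstanceAs (Subsingleton (Fin 1))
    · simp at hh

variable {ρ μ hm} in
theorem stripCx_isGradedBy (hρ : ρ.IsGraded μ hm) (i : Fin (D.numEvents + 1)) (j : ℕ) :
    (ρ.stripCx μ hm x r i j).IsGradedBy fun p => μ.reduce hm ⟨i, p⟩ := by
  refine TriComplex.IsGradedBy.slides (fun h hh => ?_)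
    (TriComplex.IsGradedBy.unslides (fun h hh => reduce_eq_of_mem_stripMarksAfter x r hρ hh)
      (stdComplex_isGradedBy _ _ (hρ.reduce_companion i)))
  have hh := List.mem_of_mem_take hh
  rw [stripMarks, List.mem_append] at hh
  rcases hh with hh | hh
  · exact reduce_eq_of_mem_stripMarksAfter x r hρ hh
  · exact reduce_eq_of_mem_stripMarksBefore r hρ hh

/-- The first handleslide coefficient at a switch is, up to the sign for type S3, the variable of
the switch. -/
def Compatible : Prop := ∀ i, ρ.IsSwitch i →
  r i = if (D.piece i).IsNestedBelow (ρ.pairing i.castSucc) then -(ρ.switchVar x i : F)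
    else ρ.switchVar x i

variable {ρ x r} in
theorem Compatible.complexStep (hr : ρ.Compatible x r) (i : Fin D.numEvents) :
    (D.piece i).ComplexStep
      (ρ.stripCx μ hm x r i.castSucc (ρ.stripMarks μ hm x r i.castSucc).length)
      (ρ.stripCx μ hm x r i.succ 0) := by
  rw [stripCx_castSucc_length, stripCx_succ_zero]
  exact Piece.complexStep_stdComplex (ρ.involutive _) (ρ.fixedPointFree _) (ρ.involutive _)
    (ρ.step i) (ρ.coeffStep_diskCoeff x i) (hr i) .inl HasMarks.carriesMarks

theorem leftCuspSimple_stripCx (i : Fin D.numEvents) :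
    (D.piece i).LeftCuspSimple (ρ.stripCx μ hm x r i.succ 0) := by
  rw [stripCx_succ_zero]
  exact Piece.leftCuspSimple_stdComplex (ρ.involutive _) (ρ.step i)
    (ρ.coeffStep_diskCoeff x i).2 _ _ _

/-- The coefficient before the right cusp of a disk is the left-hand side of its disk equation. -/
theorem stripCx_coeff_of_rightCusp {i : Fin D.numEvents} {u l : Fin (D.strands i.castSucc)}
    (hc : (D.piece i).IsRightCuspAt u l) :
    (ρ.stripCx μ hm x r i.castSucc (ρ.stripMarks μ hm x r i.castSucc).length).coeff u l =
      ρ.diskProduct x (ρ.disk ⟨i.castSucc, u⟩) := by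
  rw [stripCx_castSucc_length, stripComplex,
    Piece.slides_leftMarks_of_rightCusp (ρ.involutive _) (ρ.step i) _ hc,
    ← ρ.diskCoeff_eq_diskProduct x hc]
  have h1 := hc.companion (ρ.step i)
  subst h1
  exact stdComplex_coeff (ρ.involutive _) _ hc.lt

/-- An SR-form with simple left cusps is determined by its first handleslide coefficients. -/
theorem Compatible.rigid {ρ : D.NormalRuling} {x : ρ.Switch → Fˣ} {r : Fin D.numEvents → F}
    (hr : ρ.Compatible x r) {C : D.MCS M F} (hs : C.HasSimpleLeftCusps)
    (hC : C.HasSRMarks ρ μ hm r) (i : Fin (D.numEvents + 1)) :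
    C.marks i = ρ.stripMarks μ hm x r i ∧ C.cx i 0 = ρ.stripCx μ hm x r i 0 := by
  induction i using Fin.induction with
  | zero =>
    refine ⟨hC 0, ?_⟩
    ext1
    exact linearMap_ext_single fun p => (not_strand_zero p).elim
  | succ i ih =>
    have hcx : ∀ j hj, C.cx i.castSucc ⟨j, hj⟩ = ρ.stripCx μ hm x r i.castSucc j := by
      intro j hj
      rw [C.cx_eq_slides, ih.2, ih.1]
      rfl
    constructor
    · rw [hC i.succ, stripMarks, stripMarksAfter_succ]
      congr 1
      show C.marksAfter ρ μ hm r i = _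
      rw [MCS.marksAfter, eventMarksAfter]
      by_cases hi : ρ.HasMarks μ hm i
      · rw [if_pos hi, if_pos hi, MCS.beforeLast, hcx, ih.1,
          stripCx_castSucc_pred_length _ _ _ _ _ hi]
      · rw [if_neg hi, if_neg hi]
    · have h1 := C.step i
      rw [Fin.last, hcx, ih.1] at h1
      exact h1.unique (hr.complexStep μ hm i) (hs i) (ρ.leftCuspSimple_stripCx μ hm x r i)

/-! ### The bijection -/

variable {ρ μ hm}

theorem compatible_firstCoeff (P : ρ.ParamSpace μ hm F) :
    ρ.Compatible P.2.1 (ρ.firstCoeff μ hm P) := by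
  intro i hi
  simp only [firstCoeff, switchVar, hi, dif_pos]

theorem diskProduct_of_marked {t : D.Component → Fˣ} {x : ρ.Switch → Fˣ}
    (h : ∀ δ, ρ.DiskEquation M t x δ) {K : D.Component} {u l : Fin (D.strands (M.cusp K).castSucc)}
    (hc : (D.piece (M.cusp K)).IsRightCuspAt u l) :
    ρ.diskProduct x (ρ.disk ⟨(M.cusp K).castSucc, u⟩) = -t K :=
  (h _).1 K ⟨u, l, hc, rfl⟩

theorem diskProduct_of_unmarked {t : D.Component → Fˣ} {x : ρ.Switch → Fˣ}
    (h : ∀ δ, ρ.DiskEquation M t x δ) {i : Fin D.numEvents} {u l : Fin (D.strands i.castSucc)}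
    (hc : (D.piece i).IsRightCuspAt u l) (hi : ¬ ∃ K, M.cusp K = i) :
    ρ.diskProduct x (ρ.disk ⟨i.castSucc, u⟩) = -1 :=
  (h _).2 fun K hK => hi ⟨K, hK.unique ρ ⟨u, l, hc, rfl⟩⟩

/-- The SR-form determined by a solution of the disk equations. -/
def srForm (P : ρ.diskVariety μ hm F M) : D.MCS M F where
  marks := ρ.stripMarks μ hm P.1.2.1 (ρ.firstCoeff μ hm P.1)
  marks_lt _ _ hh := ρ.lt_of_mem_stripMarks μ hm _ _ hh
  cx i j := ρ.stripCx μ hm P.1.2.1 (ρ.firstCoeff μ hm P.1) i j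
  slide i j := by
    simp only [Fin.val_castSucc, Fin.val_succ, List.get_eq_getElem, stripCx]
    rw [List.take_succ_eq_append_getElem j.2, slides_append]
    exact isComplexIso_slide _ (ρ.lt_of_mem_stripMarks μ hm _ _ (List.getElem_mem j.2)) _
  coeffCondition i := by
    refine Piece.coeffCondition_of_complexStep ((compatible_firstCoeff P.1).complexStep μ hm i)
      (ρ.leftCuspSimple_stripCx μ hm _ _ i) fun u l hc => ?_
    rw [stripCx_coeff_of_rightCusp _ _ _ _ _ hc]
    split_ifs with hi
    · obtain ⟨K, rfl⟩ := hi
      refine ⟨P.1.1 K, ?_⟩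
      rw [diskProduct_of_marked P.2 hc, Units.val_neg]
    · rw [diskProduct_of_unmarked P.2 hc hi, Units.val_neg, Units.val_one]
  step i := (compatible_firstCoeff P.1).complexStep μ hm i

theorem srForm_hasSRMarks (P : ρ.diskVariety μ hm F M) :
    (srForm P).HasSRMarks ρ μ hm (ρ.firstCoeff μ hm P.1) := by
  intro i
  induction i using Fin.cases with
  | zero => rfl
  | succ i =>
    show ρ.stripMarksAfter μ hm _ _ _ ++ _ = _
    congr 1
    show ρ.eventMarksAfter μ hm _ _ i = (srForm P).marksAfter ρ μ hm _ i
    rw [MCS.marksAfter, eventMarksAfter]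
    by_cases hi : ρ.HasMarks μ hm i
    · rw [if_pos hi, if_pos hi]
      congr 1
      exact (ρ.stripCx_castSucc_pred_length μ hm _ _ hi).symm
    · rw [if_neg hi, if_neg hi]

theorem srForm_assignsValue (P : ρ.diskVariety μ hm F M) (K : D.Component) :
    (srForm P).AssignsValue K (P.1.1 K) := by
  obtain ⟨u, l, hc, -⟩ := M.spec K
  refine ⟨u, l, hc, ?_⟩
  refine (ρ.stripCx_coeff_of_rightCusp μ hm _ _ hc).trans ?_
  rw [diskProduct_of_marked P.2 hc, Units.val_neg]

theorem firstCoeff_ne_zero (P : ρ.ParamSpace μ hm F) {i : Fin D.numEvents} (hi : ρ.IsSwitch i) :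
    ρ.firstCoeff μ hm P i ≠ 0 := by
  rw [firstCoeff, dif_pos hi]
  split_ifs
  · exact neg_ne_zero.2 (Units.ne_zero _)
  · exact Units.ne_zero _

theorem srForm_isSRForm (hρ : ρ.IsGraded μ hm) (P : ρ.diskVariety μ hm F M) :
    (srForm P).IsSRForm ρ μ hm := by
  refine ⟨⟨fun i l j k h => stripCx_isGradedBy _ _ hρ i l j k h, fun i h hh => ?_⟩,
    fun i => ρ.leftCuspSimple_stripCx μ hm _ _ i, _, fun i hi => firstCoeff_ne_zero P.1 hi,
    srForm_hasSRMarks P⟩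
  rcases List.mem_append.1 hh with hh | hh
  · exact reduce_eq_of_mem_stripMarksAfter _ _ hρ hh
  · exact reduce_eq_of_mem_stripMarksBefore _ hρ hh

theorem eq_srForm {C : D.MCS M F} (hs : C.HasSimpleLeftCusps) (P : ρ.diskVariety μ hm F M)
    (hC : C.HasSRMarks ρ μ hm (ρ.firstCoeff μ hm P.1)) : C = srForm P := by
  have h := (compatible_firstCoeff P.1).rigid μ hm hs hC
  refine MCS.ext_of_cx (fun i => (h i).1) fun i j hj hj' => ?_
  rw [C.cx_eq_slides, (h i).2, (h i).1]
  rfl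

/-- The first handleslide coefficients of a Morse complex sequence in SR-form can be read off from
its marks. -/
theorem _root_.Legendrian.FrontDiagram.MCS.HasSRMarks.coeff_unique {C : D.MCS M F}
    {r r' : Fin D.numEvents → F} (h : C.HasSRMarks ρ μ hm r) (h' : C.HasSRMarks ρ μ hm r')
    {i : Fin D.numEvents} (hi : ρ.HasMarks μ hm i) : r i = r' i := by
  have e := (h i.castSucc).symm.trans (h' i.castSucc)
  simp only [Fin.lastCases_castSucc] at e
  have hl : ∀ r : Fin D.numEvents → F, MCS.marksBefore ρ μ hm r i = (D.piece i).leftMarks (r i) :=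
    fun r => if_pos hi
  rw [hl, hl] at e
  have hpc := hi.carriesMarks.not_leftCusp
  have := (List.append_inj' e (by
    rw [Piece.length_leftMarks hpc, Piece.length_leftMarks hpc])).2
  exact Piece.leftMarks_injective hpc this

theorem _root_.Legendrian.FrontDiagram.MCS.HasSRMarks.congr {C : D.MCS M F}
    {r r' : Fin D.numEvents → F} (h : C.HasSRMarks ρ μ hm r)
    (hr : ∀ i, ρ.HasMarks μ hm i → r i = r' i) : C.HasSRMarks ρ μ hm r' := by
  have h1 : C.marksAfter ρ μ hm r = C.marksAfter ρ μ hm r' := by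
    funext i
    rw [MCS.marksAfter, MCS.marksAfter]
    by_cases hi : ρ.HasMarks μ hm i
    · rw [hr i hi]
    · rw [if_neg hi, if_neg hi]
  have h2 : MCS.marksBefore ρ μ hm r = MCS.marksBefore ρ μ hm r' := by
    funext i
    rw [MCS.marksBefore, MCS.marksBefore]
    by_cases hi : ρ.HasMarks μ hm i
    · rw [hr i hi]
    · rw [if_neg hi, if_neg hi]
  intro i
  rw [h i, h1, h2]

theorem srForm_injective :
    Function.Injective (srForm : ρ.diskVariety μ hm F M → D.MCS M F) := by
  intro P P' h
  have hP := srForm_hasSRMarks P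
  have hP' := srForm_hasSRMarks P'
  rw [← h] at hP'
  have hr : ∀ i, ρ.HasMarks μ hm i → ρ.firstCoeff μ hm P.1 i = ρ.firstCoeff μ hm P'.1 i :=
    fun i hi => hP.coeff_unique hP' hi
  have ht : P.1.1 = P'.1.1 := by
    funext K
    obtain ⟨u, l, hc, e⟩ := srForm_assignsValue P K
    obtain ⟨u', l', hc', e'⟩ := srForm_assignsValue P' K
    rw [← h] at e'
    obtain ⟨rfl, rfl⟩ := hc.unique hc'
    exact Units.ext (neg_injective (e.symm.trans e'))
  have hx : P.1.2.1 = P'.1.2.1 := by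
    funext ⟨i, hi⟩
    have e := hr i (.inl hi)
    rw [firstCoeff, firstCoeff, dif_pos hi, dif_pos hi] at e
    split_ifs at e
    · exact Units.ext (neg_injective e)
    · exact Units.ext e
  have hz : P.1.2.2 = P'.1.2.2 := by
    funext ⟨i, hi⟩
    have e := hr i (.inr hi)
    have hi' := not_isSwitch_of_isGradedReturnOrCusp hi
    rwa [firstCoeff, firstCoeff, dif_neg hi', dif_neg hi', dif_pos hi, dif_pos hi] at e
  exact Subtype.ext (Prod.ext ht (Prod.ext hx hz))

theorem srForm_surjective {C : D.MCS M F} (hC : C.IsSRForm ρ μ hm) :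
    ∃ P : ρ.diskVariety μ hm F M, srForm P = C := by
  obtain ⟨-, hs, r, hr0, hr⟩ := hC
  have ht : ∀ K, ∃ v : Fˣ, C.AssignsValue K v := by
    intro K
    obtain ⟨u, l, hc, -⟩ := M.spec K
    have := (C.coeffCondition (M.cusp K)).rightCusp hc
    rw [if_pos ⟨K, rfl⟩] at this
    obtain ⟨v, hv⟩ := this
    exact ⟨v, u, l, hc, hv⟩
  choose t ht using ht
  let P : ρ.ParamSpace μ hm F := ⟨t, fun j =>
    if (D.piece j.1).IsNestedBelow (ρ.pairing j.1.castSucc) then -Units.mk0 (r j.1) (hr0 _ j.2)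
    else Units.mk0 (r j.1) (hr0 _ j.2), fun j => r j.1⟩
  have hPr : ∀ i, ρ.HasMarks μ hm i → r i = ρ.firstCoeff μ hm P i := by
    rintro i (hi | hi)
    · rw [firstCoeff, dif_pos hi]
      by_cases hn : (D.piece i).IsNestedBelow (ρ.pairing i.castSucc) <;> simp [P, hn]
    · rw [firstCoeff, dif_neg (not_isSwitch_of_isGradedReturnOrCusp hi), dif_pos hi]
  have hr' := hr.congr hPr
  have hrig := (compatible_firstCoeff P).rigid μ hm hs hr'
  -- the coefficients of `C` before right cusps are the left-hand sides of the disk equations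
  have hcoeff : ∀ (i : Fin D.numEvents) (u l : Fin (D.strands i.castSucc)),
      (D.piece i).IsRightCuspAt u l → (C.cx i.castSucc (Fin.last _)).coeff u l =
        ρ.diskProduct P.2.1 (ρ.disk ⟨i.castSucc, u⟩) := by
    intro i u l hc
    rw [← ρ.stripCx_coeff_of_rightCusp μ hm P.2.1 (ρ.firstCoeff μ hm P) hc, Fin.last,
      C.cx_eq_slides, (hrig i.castSucc).2, (hrig i.castSucc).1]
    rfl
  have hP : P ∈ ρ.diskVariety μ hm F M := by
    intro δ
    constructor
    · rintro K ⟨u, l, hc, rfl⟩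
      obtain ⟨u', l', hc', e⟩ := ht K
      obtain ⟨rfl, rfl⟩ := hc.unique hc'
      rw [hcoeff _ u l hc] at e
      exact Units.ext (by rw [e, Units.val_neg])
    · intro hK
      obtain ⟨i, u, l, hc, rfl⟩ := ρ.exists_endsAt δ
      have e := (C.coeffCondition i).rightCusp hc
      rw [if_neg, hcoeff i u l hc] at e
      · exact Units.ext (by rw [e, Units.val_neg, Units.val_one])
      · rintro ⟨K, rfl⟩
        exact hK K ⟨u, l, hc, rfl⟩
  exact ⟨⟨P, hP⟩, (eq_srForm hs ⟨P, hP⟩ hr').symm⟩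

end NormalRuling

end Legendrian.FrontDiagram

end

theorem theorem4p4 (D : Legendrian.FrontDiagram) (M : D.MarkedPoints) (o : D.Orientation)
    (μ : D.MaslovPotential (2 * o.linkRotation)) (m : ℕ) (hm : m ∣ 2 * o.linkRotation)
    (ρ : D.NormalRuling) (hρ : ρ.IsGraded μ hm) (F : Type*) [Field F] :
    ∃ Λ : ρ.diskVariety μ hm F M ≃ {C : D.MCS M F // C.IsSRForm ρ μ hm},
      ∀ P : ρ.diskVariety μ hm F M,
        (Λ P).1.HasSRMarks ρ μ hm (ρ.firstCoeff μ hm P.1) ∧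
        ∀ K : D.Component, (Λ P).1.AssignsValue K (P.1.1 K) := by
  refine ⟨Equiv.ofBijective
    (fun P => ⟨Legendrian.FrontDiagram.NormalRuling.srForm P,
      Legendrian.FrontDiagram.NormalRuling.srForm_isSRForm hρ P⟩) ⟨fun P P' h => ?_, fun C => ?_⟩,
    fun P => ⟨Legendrian.FrontDiagram.NormalRuling.srForm_hasSRMarks P,
      Legendrian.FrontDiagram.NormalRuling.srForm_assignsValue P⟩⟩
  · exact Legendrian.FrontDiagram.NormalRuling.srForm_injective (congrArg Subtype.val h)
  · obtain ⟨P, hP⟩ := Legendrian.FrontDiagram.NormalRuling.srForm_surjective C.2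
    exact ⟨P, Subtype.ext hP⟩
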